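/- A *quantaloid* is a category whose hom-sets are complete lattices such that composition preserves arbitrary suprema in each variable; a *homomorphism* is a functor preserving suprema of morphisms, and two quantaloids are equivalent if some homomorphism between them is an equivalence of categories. An *involution* is a supremum-preserving, identity-on-objects contravariant operation $f\mapsto f^{o}$ with $f^{oo}=f$; homomorphisms of involutive quantaloids must also preserve it. Such a homomorphism is an *equivalence of involutive quantaloids* if it has a pseudo-inverse which is again a homomorphism of involutive quantaloids, up to natural isomorphisms whose components $u$ satisfy $u^{-1}=u^{o}$. For a small site $(\mathcal C,J)$, let $\mathcal R(\mathcal C,J)$ be the quantaloid whose objects are those of $\mathcal C$ and whose morphisms $X\to Y$ are the closed cribles, i.e. the sets $R$ of spans $X\xleftarrow{f}W\xrightarrow{g}Y$ in $\mathcal C$ which are closed under precomposition and contain $(f,g)$ as soon as $(fs,gs)\in R$ for all $s$ in some $J$-covering sieve of $W$; they are ordered by inclusion, the composite is the closure of the relational composite, and the identity on $X$ is the closure of $\{(f,f)\}$. A small involutive quantaloid $\mathcal Q$ is a *small quantaloid of closed cribles* if its underlying quantaloid is equivalent to $\mathcal R(\mathcal C,J)$ for some small site $(\mathcal C,J)$,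 and its involution is the canonical one: for $q\colon Y\to X$, $$q^{o}=\bigvee\{\,g f^{*}\mid f\colon W\to X,\ g\colon W\to Y \text{ left adjoints with } f g^{*}\le q\,\},$$ where $f\dashv f^{*}$ and $g\dashv g^{*}$. For a small involutive quantaloid $\mathcal Q$ with object set $\mathcal Q_0$, let $\mathcal Q^{\mathsf m}$ be its Morita-equivalent quantale, namely the involutive quantale (one-object quantaloid) of matrices $(M(Y,X)\colon X\to Y)_{X,Y\in\mathcal Q_0}$ of morphisms of $\mathcal Q$, with multiplication $(N\circ M)(Z,X)=\bigvee_Y N(Z,Y)\circ M(Y,X)$, elementwise suprema, involution $M^{o}(X,Y)=M(Y,X)^{o}$, and as unit the matrix with identities on the diagonal and zero (bottom) morphisms elsewhere. For $f\colon A\to B$ in $\mathcal Q$, let $M_f\in\mathcal Q^{\mathsf m}$ be the matrix with all elements zero except $M_f(B,A)=f$. For a class $\mathcal E$ of symmetric idempotents ($e\circ e=e=e^{o}$) in an involutive quantaloid $\mathcal P$, let $\mathcal P_{\mathcal E}$ be the involutive quantaloid with object set $\mathcal E$ and $\mathcal P_{\mathcal E}(e,f)=\{x\mid f\circ x=x=x\circ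 e\}$, the identity on $e$ being $e$, and composition, suprema and involution being as in $\mathcal P$. Finally let $\mathsf{SymDist}(\mathcal Q)$ be the involutive quantaloid whose objects are the symmetric $\mathcal Q$-enriched categories $\mathbb A$ (a set of objects $x$ with types $tx\in\mathcal Q_0$ and hom-arrows $\mathbb A(y,x)\colon tx\to ty$ with $1_{tx}\le\mathbb A(x,x)$, $\mathbb A(z,y)\circ\mathbb A(y,x)\le\mathbb A(z,x)$ and $\mathbb A(x,y)=\mathbb A(y,x)^{o}$), and whose morphisms $\mathbb A\to\mathbb B$ are the distributors (families $\Phi(y,x)\colon tx\to ty$ with $\mathbb B(y',y)\circ\Phi(y,x)\le\Phi(y',x)$ and $\Phi(y,x)\circ\mathbb A(x,x')\le\Phi(y,x')$), composed by $(\Psi\otimes\Phi)(z,x)=\bigvee_y\Psi(z,y)\circ\Phi(y,x)$, with elementwise suprema and $\Phi^{o}(x,y)=\Phi(y,x)^{o}$. A homomorphism $F\colon\mathcal Q\to\mathcal Q'$ of small involutive quantaloids induces the homomorphism $\mathsf{SymDist}(\mathcal Q)\to\mathsf{SymDist}(\mathcal Q')$ of involutive quantaloids that applies $F$ to all types, hom-arrows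 and distributor elements. **Proposition.** Let $\mathcal Q$ be a small quantaloid of closed cribles, $\mathcal Q^{\mathsf m}$ its Morita-equivalent quantale, and $\mathcal E$ a class of symmetric idempotents in $\mathcal Q^{\mathsf m}$ containing $M_{1_A}$ for every object $A$ of $\mathcal Q$. Then $(\mathcal Q^{\mathsf m})_{\mathcal E}$ is a small quantaloid of closed cribles, and the homomorphism $\mathcal Q\to(\mathcal Q^{\mathsf m})_{\mathcal E}$, $(f\colon A\to B)\mapsto(M_f\colon M_{1_A}\to M_{1_B})$, induces an equivalence $\mathsf{SymDist}(\mathcal Q)\simeq\mathsf{SymDist}((\mathcal Q^{\mathsf m})_{\mathcal E})$ of involutive quantaloids. -/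

import Mathlib

open CategoryTheory

universe v u v' u'

namespace QuantaloidTheory

/-! ### Quantaloids, involutions, homomorphisms

Composition is written in diagrammatic order: `f ≫ g` is the composite `g ∘ f`. -/

/-- A quantaloid: a category enriched in complete lattices and supremum-preserving functions. -/
class Quantaloid (Q : Type u) [Category.{v} Q] where
  homLattice : ∀ X Y : Q, CompleteLattice (X ⟶ Y)
  sSup_comp : ∀ {X Y Z : Q} (S : Set (X ⟶ Y)) (g : Y ⟶ Z), sSup S ≫ g = ⨆ f ∈ S, f ≫ g
  comp_sSup : ∀ {X Y Z : Q} (f : X ⟶ Y) (S : Set (Y ⟶ Z)), f ≫ sSup S = ⨆ g ∈ S, f ≫ g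

attribute [reducible, instance] Quantaloid.homLattice

section

variable {Q : Type u} [Category.{v} Q] [Quantaloid Q]

theorem iSup_comp {ι : Sort*} {X Y Z : Q} (f : ι → (X ⟶ Y)) (g : Y ⟶ Z) :
    (⨆ i, f i) ≫ g = ⨆ i, f i ≫ g := by
  rw [iSup, Quantaloid.sSup_comp, iSup_range]

theorem comp_iSup {ι : Sort*} {X Y Z : Q} (f : X ⟶ Y) (g : ι → (Y ⟶ Z)) :
    f ≫ (⨆ i, g i) = ⨆ i, f ≫ g i := by
  rw [iSup, Quantaloid.comp_sSup, iSup_range]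

theorem comp_mono {X Y Z : Q} {f f' : X ⟶ Y} {g g' : Y ⟶ Z} (hf : f ≤ f') (hg : g ≤ g') :
    f ≫ g ≤ f' ≫ g' := by
  have h1 : f ≫ g ≤ f' ≫ g := by
    have : f' = sSup {f, f'} := by rw [sSup_pair, sup_eq_right.2 hf]
    rw [this, Quantaloid.sSup_comp]
    exact le_iSup₂_of_le f (by simp) le_rfl
  have h2 : f' ≫ g ≤ f' ≫ g' := by
    have : g' = sSup {g, g'} := by rw [sSup_pair, sup_eq_right.2 hg]
    rw [this, Quantaloid.comp_sSup]
    exact le_iSup₂_of_le g (by simp) le_rfl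
  exact h1.trans h2

/-- `f` is left adjoint to `g`: `1 ≤ g ∘ f` and `f ∘ g ≤ 1`. -/
def IsAdjointPair {X Y : Q} (f : X ⟶ Y) (g : Y ⟶ X) : Prop :=
  𝟙 X ≤ f ≫ g ∧ g ≫ f ≤ 𝟙 Y

end

/-- An involution on a quantaloid: a homomorphism `Qᵒᵖ → Q` that is the identity on objects and
squares to the identity. -/
class InvolutiveQuantaloid (Q : Type u) [Category.{v} Q] [Quantaloid Q] where
  inv : ∀ {X Y : Q}, (X ⟶ Y) → (Y ⟶ X)
  inv_inv : ∀ {X Y : Q} (f : X ⟶ Y), inv (inv f) = f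
  inv_id : ∀ X : Q, inv (𝟙 X) = 𝟙 X
  inv_comp : ∀ {X Y Z : Q} (f : X ⟶ Y) (g : Y ⟶ Z), inv (f ≫ g) = inv g ≫ inv f
  inv_sSup : ∀ {X Y : Q} (S : Set (X ⟶ Y)), inv (sSup S) = ⨆ f ∈ S, inv f

/-- The involute of a morphism. -/
postfix:max "ᵒ" => InvolutiveQuantaloid.inv

section

variable {Q : Type u} [Category.{v} Q] [Quantaloid Q] [InvolutiveQuantaloid Q]

theorem inv_iSup {ι : Sort*} {X Y : Q} (f : ι → (X ⟶ Y)) : (⨆ i, f i)ᵒ = ⨆ i, (f i)ᵒ := by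
  rw [iSup, InvolutiveQuantaloid.inv_sSup, iSup_range]

theorem inv_mono {X Y : Q} {f g : X ⟶ Y} (h : f ≤ g) : fᵒ ≤ gᵒ := by
  have : g = sSup {f, g} := by rw [sSup_pair, sup_eq_right.2 h]
  rw [this, InvolutiveQuantaloid.inv_sSup]
  exact le_iSup₂_of_le f (by simp) le_rfl

theorem inv_eqToHom {X Y : Q} (h : X = Y) : (eqToHom h)ᵒ = eqToHom h.symm := by
  subst h
  simp [InvolutiveQuantaloid.inv_id]

end

/-- A functor between quantaloids is a homomorphism when it preserves suprema of morphisms. -/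
def IsHomomorphism {Q : Type u} [Category.{v} Q] [Quantaloid Q]
    {R : Type u'} [Category.{v'} R] [Quantaloid R] (F : Q ⥤ R) : Prop :=
  ∀ {X Y : Q} (S : Set (X ⟶ Y)), F.map (sSup S) = ⨆ f ∈ S, F.map f

/-- Two quantaloids are equivalent when there is a homomorphism between them that is an equivalence
of categories. (It is then an order isomorphism on hom-lattices, so that each of its
pseudo-inverses is a homomorphism too.) -/
def QuantaloidEquivalent (Q : Type u) [Category.{v} Q] [Quantaloid Q]
    (R : Type u') [Category.{v'} R] [Quantaloid R] : Prop :=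
  ∃ F : Q ⥤ R, IsHomomorphism F ∧ F.IsEquivalence

/-- A homomorphism of involutive quantaloids. -/
structure InvolutiveHom (Q : Type u) [Category.{v} Q] [Quantaloid Q] [InvolutiveQuantaloid Q]
    (R : Type u') [Category.{v'} R] [Quantaloid R] [InvolutiveQuantaloid R] extends Q ⥤ R where
  map_sSup : IsHomomorphism toFunctor
  map_inv : ∀ {X Y : Q} (f : X ⟶ Y), toFunctor.map (fᵒ) = (toFunctor.map f)ᵒ

/-- A homomorphism of involutive quantaloids is an equivalence of involutive quantaloids when it has
a pseudo-inverse that is again a homomorphism of involutive quantaloids; the natural isomorphisms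
that witness this are required to be symmetric (the inverse of each component is its involute). -/
def InvolutiveHom.IsEquivalence {Q : Type u} [Category.{v} Q] [Quantaloid Q]
    [InvolutiveQuantaloid Q] {R : Type u'} [Category.{v'} R] [Quantaloid R]
    [InvolutiveQuantaloid R] (F : InvolutiveHom Q R) : Prop :=
  ∃ (G : InvolutiveHom R Q)
    (η : 𝟭 Q ≅ F.toFunctor ⋙ G.toFunctor) (ε : G.toFunctor ⋙ F.toFunctor ≅ 𝟭 R),
    (∀ A, η.inv.app A = (η.hom.app A)ᵒ) ∧ ∀ B, ε.inv.app B = (ε.hom.app B)ᵒ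

section

variable {Q : Type u} [Category.{v} Q] [Quantaloid Q] [InvolutiveQuantaloid Q]
  {R : Type u'} [Category.{v'} R] [Quantaloid R] [InvolutiveQuantaloid R]

theorem InvolutiveHom.map_iSup (F : InvolutiveHom Q R) {ι : Sort*} {X Y : Q} (f : ι → (X ⟶ Y)) :
    F.map (⨆ i, f i) = ⨆ i, F.map (f i) := by
  rw [iSup, F.map_sSup, iSup_range]

theorem InvolutiveHom.map_mono (F : InvolutiveHom Q R) {X Y : Q} {f g : X ⟶ Y} (h : f ≤ g) :
    F.map f ≤ F.map g := by
  have : g = sSup {f, g} := by rw [sSup_pair, sup_eq_right.2 h]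
  rw [this, F.map_sSup]
  exact le_iSup₂_of_le f (by simp) le_rfl

end

/-! ### The quantaloid of closed cribles in a site -/

section Site

variable {C : Type u} [SmallCategory C]

/-- A crible (of spans) from `X` to `Y`: a set of spans `X ← W → Y` that is closed under
precomposition. -/
@[ext]
structure Crible (X Y : C) where
  rel : ∀ {W : C}, (W ⟶ X) → (W ⟶ Y) → Prop
  precomp : ∀ {W V : C} (t : V ⟶ W) {f : W ⟶ X} {g : W ⟶ Y}, rel f g → rel (t ≫ f) (t ≫ g)

/-- The sieve of all arrows `t` along which a span `(f, g)` restricts to an element of the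
crible. -/
def Crible.sieve {X Y : C} (R : Crible X Y) {W : C} (f : W ⟶ X) (g : W ⟶ Y) : Sieve W where
  arrows _ t := R.rel (t ≫ f) (t ≫ g)
  downward_closed h s := by simpa using R.precomp s h

/-- A closed crible: each span which belongs to the crible locally (that is, after restriction
along the arrows of a covering sieve) belongs to it. -/
@[ext]
structure ClosedCrible (J : GrothendieckTopology C) (X Y : C) extends Crible X Y where
  closed : ∀ {W : C} (f : W ⟶ X) (g : W ⟶ Y), toCrible.sieve f g ∈ J W → rel f g

/-- The closure of a crible: all spans that belong to it locally. -/
def Crible.closure (J : GrothendieckTopology C) {X Y : C} (R : Crible X Y) :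
    ClosedCrible J X Y where
  rel {W} f g := R.sieve f g ∈ J W
  precomp t f g h := by
    have : R.sieve (t ≫ f) (t ≫ g) = (R.sieve f g).pullback t := by
      ext U s
      simp [Crible.sieve]
    rw [this]
    exact J.pullback_stable t h
  closed f g h := by
    refine J.transitive h _ fun _ t ht => ?_
    have : (R.sieve f g).pullback t = R.sieve (t ≫ f) (t ≫ g) := by
      ext U s
      simp [Crible.sieve]
    rw [this]
    exact ht

/-- Relational composition of cribles. -/
def Crible.comp {X Y Z : C} (R : Crible X Y) (S : Crible Y Z) : Crible X Z where
  rel {W} f h := ∃ g : W ⟶ Y, R.rel f g ∧ S.rel g h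
  precomp t _ _ := fun ⟨g, h1, h2⟩ => ⟨t ≫ g, R.precomp t h1, S.precomp t h2⟩

/-- The crible of all spans with equal legs. -/
def Crible.diag (X : C) : Crible X X where
  rel f g := f = g
  precomp _ _ _ h := by rw [h]

/-- The union of a set of closed cribles. -/
def Crible.union {J : GrothendieckTopology C} {X Y : C} (S : Set (ClosedCrible J X Y)) :
    Crible X Y where
  rel f g := ∃ R ∈ S, R.rel f g
  precomp t _ _ := fun ⟨R, hR, h⟩ => ⟨R, hR, R.precomp t h⟩

/-- The objects of the quantaloid of closed cribles in `(C, J)`: the objects of `C`. -/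
structure ClosedCribles (J : GrothendieckTopology C) where
  of :: obj : C

variable {J : GrothendieckTopology C}

theorem Crible.le_closure {X Y : C} (R : Crible X Y) {W : C} {f : W ⟶ X} {g : W ⟶ Y}
    (h : R.rel f g) : (R.closure J).rel f g := by
  change R.sieve f g ∈ J W
  have : R.sieve f g = ⊤ := by
    ext V t
    simpa [Crible.sieve] using R.precomp t h
  rw [this]
  exact J.top_mem W

theorem Crible.closure_le {X Y : C} (R : Crible X Y) (T : ClosedCrible J X Y)
    (h : ∀ {W : C} (f : W ⟶ X) (g : W ⟶ Y), R.rel f g → T.rel f g)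
    {W : C} {f : W ⟶ X} {g : W ⟶ Y} (hf : (R.closure J).rel f g) : T.rel f g :=
  T.closed f g (J.superset_covering (fun _ _ ht => h _ _ ht) hf)

theorem ClosedCrible.ext_iff' {X Y : C} {R S : ClosedCrible J X Y}
    (h : ∀ {W : C} (f : W ⟶ X) (g : W ⟶ Y), R.rel f g ↔ S.rel f g) : R = S := by
  apply ClosedCrible.ext
  funext W f g
  exact propext (h f g)

/-- Closed cribles are ordered by inclusion. -/
instance (X Y : C) : PartialOrder (ClosedCrible J X Y) where
  le R S := ∀ ⦃W : C⦄ (f : W ⟶ X) (g : W ⟶ Y), R.rel f g → S.rel f g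
  le_refl _ _ _ _ h := h
  le_trans _ _ _ h h' _ f g hf := h' f g (h f g hf)
  le_antisymm _ _ h h' := ClosedCrible.ext_iff' fun f g => ⟨h f g, h' f g⟩

/-- The supremum of closed cribles is the closure of their union. -/
instance (X Y : C) : SupSet (ClosedCrible J X Y) where
  sSup S := (Crible.union S).closure J

instance (X Y : C) : CompleteLattice (ClosedCrible J X Y) :=
  completeLatticeOfSup _ fun S => by
    constructor
    · intro R hR W f g h
      exact Crible.le_closure _ ⟨R, hR, h⟩
    · intro T hT W f g h
      exact Crible.closure_le (Crible.union S) T (fun f g ⟨_, hR, hh⟩ => hT hR f g hh) h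

/-- Composition of closed cribles: the closure of their relational composite. -/
def ClosedCrible.comp {X Y Z : C} (R : ClosedCrible J X Y) (S : ClosedCrible J Y Z) :
    ClosedCrible J X Z :=
  (R.toCrible.comp S.toCrible).closure J

theorem ClosedCrible.comp_le {X Y Z : C} {R : ClosedCrible J X Y} {S : ClosedCrible J Y Z}
    {T : ClosedCrible J X Z}
    (h : ∀ {W : C} (f : W ⟶ X) (g : W ⟶ Y) (k : W ⟶ Z), R.rel f g → S.rel g k → T.rel f k) :
    R.comp S ≤ T := fun _ _ _ hfk =>
  Crible.closure_le (R.toCrible.comp S.toCrible) T (fun f k ⟨g, h1, h2⟩ => h f g k h1 h2) hfk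

theorem ClosedCrible.rel_comp {X Y Z : C} {R : ClosedCrible J X Y} {S : ClosedCrible J Y Z}
    {W : C} {f : W ⟶ X} {g : W ⟶ Y} {k : W ⟶ Z} (h1 : R.rel f g) (h2 : S.rel g k) :
    (R.comp S).rel f k := Crible.le_closure _ ⟨g, h1, h2⟩

theorem ClosedCrible.rel_comp_iff {X Y Z : C} {R : ClosedCrible J X Y} {S : ClosedCrible J Y Z}
    {W : C} {f : W ⟶ X} {k : W ⟶ Z} :
    (R.comp S).rel f k ↔ (R.toCrible.comp S.toCrible).sieve f k ∈ J W := Iff.rfl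

instance : Category.{u} (ClosedCribles J) where
  Hom X Y := ClosedCrible J X.obj Y.obj
  id X := (Crible.diag X.obj).closure J
  comp R S := R.comp S
  id_comp {X Y} R := by
    apply le_antisymm
    · apply ClosedCrible.comp_le
      intro W f g k h1 h2
      refine R.closed _ _ (J.superset_covering (fun V t ht => ?_) h1)
      change t ≫ f = t ≫ g at ht
      change R.rel (t ≫ f) (t ≫ k)
      rw [ht]
      exact R.precomp t h2
    · intro W f g h
      exact ClosedCrible.rel_comp (Crible.le_closure _ rfl) h
  comp_id {X Y} R := by
    apply le_antisymm
    · apply ClosedCrible.comp_le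
      intro W f g k h1 h2
      refine R.closed _ _ (J.superset_covering (fun V t ht => ?_) h2)
      change t ≫ g = t ≫ k at ht
      change R.rel (t ≫ f) (t ≫ k)
      rw [← ht]
      exact R.precomp t h1
    · intro W f g h
      exact ClosedCrible.rel_comp h (Crible.le_closure _ rfl)
  assoc {X Y Z T} R S U := by
    apply le_antisymm
    · apply ClosedCrible.comp_le
      intro W f g k h1 h2
      refine ClosedCrible.closed _ _ _ (J.superset_covering (fun V t ht => ?_) h1)
      obtain ⟨m, hm1, hm2⟩ := ht
      exact ClosedCrible.rel_comp hm1 (ClosedCrible.rel_comp hm2 (U.precomp t h2))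
    · apply ClosedCrible.comp_le
      intro W f g k h1 h2
      refine ClosedCrible.closed _ _ _ (J.superset_covering (fun V t ht => ?_) h2)
      obtain ⟨m, hm1, hm2⟩ := ht
      exact ClosedCrible.rel_comp (ClosedCrible.rel_comp (R.precomp t h1) hm1) hm2

theorem ClosedCrible.comp_le_comp {X Y Z : C} {R R' : ClosedCrible J X Y}
    {S S' : ClosedCrible J Y Z} (h : R ≤ R') (h' : S ≤ S') : R.comp S ≤ R'.comp S' :=
  ClosedCrible.comp_le fun f g k h1 h2 => ClosedCrible.rel_comp (h f g h1) (h' g k h2)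

instance (X Y : ClosedCribles J) : CompleteLattice (X ⟶ Y) :=
  inferInstanceAs (CompleteLattice (ClosedCrible J X.obj Y.obj))

/-- The small quantaloid of closed cribles in the site `(C, J)`. -/
instance : Quantaloid (ClosedCribles J) where
  homLattice _ _ := inferInstance
  sSup_comp {X Y Z} S g := by
    apply le_antisymm
    · apply ClosedCrible.comp_le
      intro W f m k h1 h2
      refine ClosedCrible.closed _ _ _ (J.superset_covering (fun V t ht => ?_) h1)
      obtain ⟨R, hR, hr⟩ := ht
      exact (le_iSup₂ (f := fun (f : X ⟶ Y) (_ : f ∈ S) => f ≫ g) R hR) _ _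
        (ClosedCrible.rel_comp hr (g.precomp t h2))
    · exact iSup₂_le (α := X ⟶ Z) fun R hR => ClosedCrible.comp_le_comp (le_sSup hR) le_rfl
  comp_sSup {X Y Z} g S := by
    apply le_antisymm
    · apply ClosedCrible.comp_le
      intro W f m k h1 h2
      refine ClosedCrible.closed _ _ _ (J.superset_covering (fun V t ht => ?_) h2)
      obtain ⟨R, hR, hr⟩ := ht
      exact (le_iSup₂ (f := fun (f : Y ⟶ Z) (_ : f ∈ S) => g ≫ f) R hR) _ _
        (ClosedCrible.rel_comp (g.precomp t h1) hr)
    · exact iSup₂_le (α := X ⟶ Z) fun R hR => ClosedCrible.comp_le_comp le_rfl (le_sSup hR)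

end Site

/-- An involutive quantaloid `Q` is a small quantaloid of closed cribles when its underlying
quantaloid is equivalent to the quantaloid of closed cribles in a small site, and its involution is
the canonical one of such a quantaloid:
`qᵒ = ⋁ {g ∘ f* | f, g left adjoints with common domain and f ∘ g* ≤ q}`. -/
structure IsSmallQuantaloidOfClosedCribles (Q : Type u) [SmallCategory Q] [Quantaloid Q]
    [InvolutiveQuantaloid Q] : Prop where
  exists_site : ∃ (C : Type u) (_ : SmallCategory C) (J : GrothendieckTopology C),
    QuantaloidEquivalent Q (ClosedCribles J)
  inv_eq : ∀ {Y X : Q} (q : Y ⟶ X),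
    qᵒ = sSup {p : X ⟶ Y | ∃ (W : Q) (f : W ⟶ X) (f' : X ⟶ W) (g : W ⟶ Y) (g' : Y ⟶ W),
      IsAdjointPair f f' ∧ IsAdjointPair g g' ∧ g' ≫ f ≤ q ∧ p = f' ≫ g}

/-! ### Matrices -/

section Matr

variable (Q : Type u) [SmallCategory Q]

/-- An object of `Matr Q`: a `Q`-typed set. -/
structure Matr where
  carrier : Type u
  type : carrier → Q

variable {Q} [Quantaloid Q]

/-- The Kronecker delta: the identity if `a = b`, and the zero morphism otherwise. -/
def Matr.delta (A : Matr Q) (a b : A.carrier) : A.type a ⟶ A.type b :=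
  ⨆ h : a = b, eqToHom (congrArg A.type h)

/-- Morphisms `A ⟶ B` in `Matr Q` are matrices; the element at `(a, b)` is
`M a b : A.type a ⟶ B.type b`. -/
instance : Category.{u} (Matr Q) where
  Hom A B := ∀ (a : A.carrier) (b : B.carrier), A.type a ⟶ B.type b
  id A := A.delta
  comp {A B D} M N := fun a d => ⨆ b : B.carrier, M a b ≫ N b d
  id_comp {A B} M := by
    funext a b
    apply le_antisymm
    · refine iSup_le fun a' => ?_
      rw [Matr.delta, iSup_comp]
      refine iSup_le fun h => ?_
      subst h
      simp
    · refine le_iSup_of_le a ?_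
      simp [Matr.delta]
  comp_id {A B} M := by
    funext a b
    apply le_antisymm
    · refine iSup_le fun b' => ?_
      rw [Matr.delta, comp_iSup]
      refine iSup_le fun h => ?_
      subst h
      simp
    · refine le_iSup_of_le b ?_
      simp [Matr.delta]
  assoc {A B D E} M N P := by
    funext a e
    simp only [iSup_comp, comp_iSup, Category.assoc]
    rw [iSup_comm]

theorem Matr.comp_apply {A B D : Matr Q} (M : A ⟶ B) (N : B ⟶ D) (a : A.carrier)
    (d : D.carrier) : (M ≫ N) a d = ⨆ b : B.carrier, M a b ≫ N b d := rfl

instance (A B : Matr Q) : CompleteLattice (A ⟶ B) :=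
  inferInstanceAs (CompleteLattice (∀ (a : A.carrier) (b : B.carrier), A.type a ⟶ B.type b))

theorem Matr.sSup_apply' {A B : Matr Q} (S : Set (A ⟶ B)) (a : A.carrier) (b : B.carrier) :
    (sSup S) a b = ⨆ M ∈ S, M a b := by
  have h1 : (sSup S) a b = (⨆ M : S, (M : A ⟶ B) a) b := congrFun (sSup_apply (s := S)) b
  rw [h1, iSup_apply, iSup_subtype]

theorem Matr.iSup_apply' {A B : Matr Q} {ι : Sort*} (M : ι → (A ⟶ B)) (a : A.carrier)
    (b : B.carrier) : (⨆ i, M i) a b = ⨆ i, M i a b := by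
  rw [iSup, Matr.sSup_apply', iSup_range]

/-- `Matr Q` is a quantaloid, with elementwise suprema. -/
instance : Quantaloid (Matr Q) where
  homLattice A B := inferInstance
  sSup_comp {A B D} S N := by
    funext a d
    simp only [Matr.comp_apply, Matr.sSup_apply', Matr.iSup_apply', iSup_comp]
    rw [iSup_comm]
    refine iSup_congr fun M => ?_
    rw [iSup_comm]
  comp_sSup {A B D} M S := by
    funext a d
    simp only [Matr.comp_apply, Matr.sSup_apply', Matr.iSup_apply', comp_iSup]
    rw [iSup_comm]
    refine iSup_congr fun M => ?_
    rw [iSup_comm]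

/-- The involution on `Matr Q` is elementwise. -/
instance [InvolutiveQuantaloid Q] : InvolutiveQuantaloid (Matr Q) where
  inv M := fun b a => (M a b)ᵒ
  inv_inv M := by
    funext a b
    exact InvolutiveQuantaloid.inv_inv _
  inv_id A := by
    funext a b
    change (A.delta b a)ᵒ = A.delta a b
    rw [Matr.delta, Matr.delta, inv_iSup]
    simp only [inv_eqToHom]
    exact le_antisymm (iSup_le fun h => le_iSup_of_le h.symm le_rfl)
      (iSup_le fun h => le_iSup_of_le h.symm le_rfl)
  inv_comp M N := by
    funext a b
    simp only [Matr.comp_apply, inv_iSup, InvolutiveQuantaloid.inv_comp]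
  inv_sSup S := by
    funext a b
    simp only [Matr.sSup_apply', Matr.iSup_apply', inv_iSup]

theorem Matr.inv_apply [InvolutiveQuantaloid Q] {A B : Matr Q} (M : A ⟶ B) (b : B.carrier)
    (a : A.carrier) : (Mᵒ) b a = (M a b)ᵒ := rfl

variable (Q) in
/-- The `Q`-typed set of objects of `Q`; the type of an object is that object. -/
def Matr.objects : Matr Q where
  carrier := Q
  type A := A

end Matr

/-! ### The quantale `Qᵐ` -/

section MatrixQuantale

/-- The unique object of the quantale `Qᵐ` of endo-matrices on the set of objects of `Q`, regarded
as a one-object quantaloid. -/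
structure MatrixQuantale (Q : Type u) : Type u where
  star ::

variable {Q : Type u} [SmallCategory Q] [Quantaloid Q]

/-- The elements of the quantale `Qᵐ` are the endo-matrices, in `Matr Q`, on the `Q`-typed set of
objects of `Q`; its multiplication is the composition of matrices. -/
instance : Category.{u} (MatrixQuantale Q) where
  Hom _ _ := Matr.objects Q ⟶ Matr.objects Q
  id _ := 𝟙 (Matr.objects Q)
  comp M N := (M ≫ N : Matr.objects Q ⟶ Matr.objects Q)
  id_comp M := Category.id_comp (obj := Matr Q) M
  comp_id M := Category.comp_id (obj := Matr Q) M
  assoc M N P := Category.assoc (obj := Matr Q) M N P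

instance : Quantaloid (MatrixQuantale Q) where
  homLattice _ _ := inferInstanceAs (CompleteLattice (Matr.objects Q ⟶ Matr.objects Q))
  sSup_comp S N := Quantaloid.sSup_comp (Q := Matr Q) S N
  comp_sSup M S := Quantaloid.comp_sSup (Q := Matr Q) M S

instance [InvolutiveQuantaloid Q] : InvolutiveQuantaloid (MatrixQuantale Q) where
  inv M := InvolutiveQuantaloid.inv (Q := Matr Q) M
  inv_inv M := InvolutiveQuantaloid.inv_inv (Q := Matr Q) M
  inv_id _ := InvolutiveQuantaloid.inv_id (Q := Matr Q) (Matr.objects Q)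
  inv_comp M N := InvolutiveQuantaloid.inv_comp (Q := Matr Q) M N
  inv_sSup S := InvolutiveQuantaloid.inv_sSup (Q := Matr Q) S

/-- The element at `(X, Y)` of the matrix `M_f`. -/
def elementaryEntry {A B : Q} (f : A ⟶ B) (X Y : Q) : X ⟶ Y :=
  ⨆ (h : X = A) (k : B = Y), eqToHom h ≫ f ≫ eqToHom k

/-- For `f : A ⟶ B` in `Q`, the matrix `M_f` all of whose elements are zero, except for the element
at `(A, B)`, which is `f`. -/
def elementaryMatrix {A B : Q} (f : A ⟶ B) :
    (MatrixQuantale.star : MatrixQuantale Q) ⟶ MatrixQuantale.star :=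
  fun X Y => elementaryEntry f X Y

theorem elementaryMatrix_comp {A B D : Q} (f : A ⟶ B) (g : B ⟶ D) :
    elementaryMatrix f ≫ elementaryMatrix g = elementaryMatrix (f ≫ g) := by
  have key : ∀ X Z : Q, (⨆ Y : Q, elementaryEntry f X Y ≫ elementaryEntry g Y Z) =
      elementaryEntry (f ≫ g) X Z := by
    intro X Z
    simp only [elementaryEntry, iSup_comp, comp_iSup]
    apply le_antisymm
    · refine iSup_le fun Y => iSup_le fun h => iSup_le fun k => iSup_le fun h' =>
        iSup_le fun k' => ?_
      subst h k h'
      simp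
    · refine iSup_le fun h => iSup_le fun k => ?_
      subst h k
      refine le_iSup_of_le B ?_
      simp
  funext X Z
  exact key X Z

theorem elementaryMatrix_sSup {A B : Q} (S : Set (A ⟶ B)) :
    elementaryMatrix (sSup S) = ⨆ f ∈ S, elementaryMatrix f := by
  have key : ∀ X Y : Q, elementaryEntry (sSup S) X Y = ⨆ f ∈ S, elementaryEntry f X Y := by
    intro X Y
    simp only [elementaryEntry]
    apply le_antisymm
    · refine iSup_le fun h => iSup_le fun k => ?_
      subst h k
      simp [sSup_eq_iSup]
    · refine iSup_le fun f => iSup_le fun hf => iSup_le fun h => iSup_le fun k => ?_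
      subst h k
      simpa using le_sSup hf
  funext X Y
  refine (key X Y).trans (Eq.symm ?_)
  refine (Matr.iSup_apply' (A := Matr.objects Q) (B := Matr.objects Q) _ X Y).trans ?_
  exact iSup_congr fun f => Matr.iSup_apply' (A := Matr.objects Q) (B := Matr.objects Q) _ X Y

theorem elementaryMatrix_inv [InvolutiveQuantaloid Q] {A B : Q} (f : A ⟶ B) :
    elementaryMatrix (fᵒ) = (elementaryMatrix f)ᵒ := by
  have key : ∀ X Y : Q, elementaryEntry (fᵒ) X Y = (elementaryEntry f Y X)ᵒ := by
    intro X Y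
    simp only [elementaryEntry, inv_iSup, InvolutiveQuantaloid.inv_comp, inv_eqToHom,
      Category.assoc]
    apply le_antisymm
    · refine iSup_le fun h => iSup_le fun k => ?_
      subst h k
      simp
    · refine iSup_le fun h => iSup_le fun k => ?_
      subst h k
      simp
  funext X Y
  exact key X Y

end MatrixQuantale

/-! ### Splitting symmetric idempotents -/

section Split

/-- A symmetric idempotent in an involutive quantaloid. -/
structure SymIdempotent (Q : Type u) [Category.{v} Q] [Quantaloid Q] [InvolutiveQuantaloid Q] where
  obj : Q
  e : obj ⟶ obj
  idem : e ≫ e = e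
  symm : eᵒ = e

variable {Q : Type u} [Category.{v} Q] [Quantaloid Q] [InvolutiveQuantaloid Q]

/-- The objects of `Q_E`: the elements of the class `E` of symmetric idempotents. -/
structure Split (E : Set (SymIdempotent Q)) where
  idempotent : SymIdempotent Q
  mem : idempotent ∈ E

/-- The morphisms `e ⟶ f` in `Q_E`: morphisms `x` of `Q` such that `f ∘ x = x = x ∘ e`. -/
@[ext]
structure SplitHom (e f : SymIdempotent Q) where
  val : e.obj ⟶ f.obj
  left : e.e ≫ val = val
  right : val ≫ f.e = val

variable {E : Set (SymIdempotent Q)}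

instance (e f : SymIdempotent Q) : PartialOrder (SplitHom e f) :=
  PartialOrder.lift SplitHom.val fun _ _ => SplitHom.ext

/-- Suprema in `Q_E` are as in `Q`. -/
instance (e f : SymIdempotent Q) : SupSet (SplitHom e f) where
  sSup S :=
    { val := ⨆ x ∈ S, x.val
      left := by simp only [comp_iSup, SplitHom.left]
      right := by simp only [iSup_comp, SplitHom.right] }

instance (e f : SymIdempotent Q) : CompleteLattice (SplitHom e f) :=
  completeLatticeOfSup _ fun S => by
    constructor
    · intro x hx
      exact le_iSup₂_of_le (f := fun (x : SplitHom e f) (_ : x ∈ S) => x.val) x hx le_rfl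
    · intro y hy
      exact iSup₂_le fun x hx => hy hx

theorem SplitHom.sSup_val {e f : SymIdempotent Q} (S : Set (SplitHom e f)) :
    (sSup S).val = ⨆ x ∈ S, x.val := rfl

theorem SplitHom.iSup_val {e f : SymIdempotent Q} {ι : Sort*} (x : ι → SplitHom e f) :
    (⨆ i, x i).val = ⨆ i, (x i).val := by
  rw [iSup, SplitHom.sSup_val, iSup_range]

/-- `Q_E`: composition is as in `Q`, and the identity on `e` is `e` itself. -/
instance : Category.{v} (Split E) where
  Hom e f := SplitHom e.idempotent f.idempotent
  id e := ⟨e.idempotent.e, e.idempotent.idem, e.idempotent.idem⟩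
  comp x y := ⟨x.val ≫ y.val, by rw [← Category.assoc, x.left], by rw [Category.assoc, y.right]⟩
  id_comp x := SplitHom.ext x.left
  comp_id x := SplitHom.ext x.right
  assoc x y z := SplitHom.ext (Category.assoc _ _ _)

theorem Split.comp_val {e f g : Split E} (x : e ⟶ f) (y : f ⟶ g) :
    (x ≫ y).val = x.val ≫ y.val := rfl

instance : Quantaloid (Split E) where
  homLattice e f := inferInstanceAs (CompleteLattice (SplitHom e.idempotent f.idempotent))
  sSup_comp {e f g} S y := by
    refine SplitHom.ext ?_
    rw [Split.comp_val, SplitHom.sSup_val, iSup_comp]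
    erw [SplitHom.iSup_val]
    refine iSup_congr fun x => ?_
    erw [SplitHom.iSup_val]
    rw [iSup_comp]
    rfl
  comp_sSup {e f g} y S := by
    refine SplitHom.ext ?_
    rw [Split.comp_val, SplitHom.sSup_val, comp_iSup]
    erw [SplitHom.iSup_val]
    refine iSup_congr fun x => ?_
    erw [SplitHom.iSup_val]
    rw [comp_iSup]
    rfl

/-- The involution on `Q_E` is as in `Q`. -/
instance : InvolutiveQuantaloid (Split E) where
  inv {e f} x :=
    { val := (x.val)ᵒ
      left := by
        have := congrArg (fun y => yᵒ) x.right
        simpa only [InvolutiveQuantaloid.inv_comp, f.idempotent.symm] using this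
      right := by
        have := congrArg (fun y => yᵒ) x.left
        simpa only [InvolutiveQuantaloid.inv_comp, e.idempotent.symm] using this }
  inv_inv x := SplitHom.ext (InvolutiveQuantaloid.inv_inv _)
  inv_id e := SplitHom.ext e.idempotent.symm
  inv_comp x y := SplitHom.ext (InvolutiveQuantaloid.inv_comp _ _)
  inv_sSup {e f} S := by
    refine SplitHom.ext ?_
    refine (inv_iSup _).trans ?_
    erw [SplitHom.iSup_val]
    refine iSup_congr fun x => ?_
    erw [SplitHom.iSup_val]
    rw [inv_iSup]

end Split

/-! ### The embedding of `Q` into `(Qᵐ)_E` -/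

section Embedding

variable {Q : Type u} [SmallCategory Q] [Quantaloid Q] [InvolutiveQuantaloid Q]

/-- The symmetric idempotent `M_{1_A}` in `Qᵐ`. -/
def elementaryIdempotent (A : Q) : SymIdempotent (MatrixQuantale Q) where
  obj := MatrixQuantale.star
  e := elementaryMatrix (𝟙 A)
  idem := by rw [elementaryMatrix_comp, Category.comp_id]
  symm := by rw [← elementaryMatrix_inv, InvolutiveQuantaloid.inv_id]

/-- The homomorphism `M : Q → (Qᵐ)_E`, sending `f : A ⟶ B` to `M_f : M_{1_A} ⟶ M_{1_B}`. -/
def matrixEmbedding (E : Set (SymIdempotent (MatrixQuantale Q)))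
    (hE : ∀ A : Q, elementaryIdempotent A ∈ E) : InvolutiveHom Q (Split E) where
  obj A := ⟨elementaryIdempotent A, hE A⟩
  map {A B} f :=
    { val := elementaryMatrix f
      left := by
        change elementaryMatrix (𝟙 A) ≫ elementaryMatrix f = _
        rw [elementaryMatrix_comp, Category.id_comp]
      right := by
        change elementaryMatrix f ≫ elementaryMatrix (𝟙 B) = _
        rw [elementaryMatrix_comp, Category.comp_id] }
  map_id A := rfl
  map_comp f g := SplitHom.ext (elementaryMatrix_comp f g).symm
  map_sSup S := by
    refine SplitHom.ext ?_
    erw [SplitHom.iSup_val]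
    refine (elementaryMatrix_sSup S).trans (iSup_congr fun f => ?_)
    erw [SplitHom.iSup_val]
  map_inv f := SplitHom.ext (elementaryMatrix_inv f)

end Embedding

/-! ### Symmetric enriched categories and distributors -/

section SymDist

/-- A category enriched in a small quantaloid `Q`: the hom-arrow `hom x y : type x ⟶ type y` is the
one from `x` to `y`. -/
structure EnrichedCat (Q : Type u) [SmallCategory Q] [Quantaloid Q] where
  carrier : Type u
  type : carrier → Q
  hom : ∀ x y : carrier, type x ⟶ type y
  id_le : ∀ x, 𝟙 (type x) ≤ hom x x
  comp_le : ∀ x y z, hom x y ≫ hom y z ≤ hom x z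

/-- A distributor between enriched categories; its element at `(x, y)` is
`elem x y : A.type x ⟶ B.type y`. -/
@[ext]
structure Distributor {Q : Type u} [SmallCategory Q] [Quantaloid Q] (A B : EnrichedCat Q) where
  elem : ∀ (x : A.carrier) (y : B.carrier), A.type x ⟶ B.type y
  left_le : ∀ x' x y, A.hom x' x ≫ elem x y ≤ elem x' y
  right_le : ∀ x y y', elem x y ≫ B.hom y y' ≤ elem x y'

section

variable {Q : Type u} [SmallCategory Q] [Quantaloid Q]

/-- The identity distributor on `A`, given by the hom-arrows of `A`. -/
def Distributor.id (A : EnrichedCat Q) : Distributor A A where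
  elem := A.hom
  left_le x' x y := A.comp_le x' x y
  right_le x y y' := A.comp_le x y y'

/-- Composition of distributors. -/
def Distributor.comp {A B D : EnrichedCat Q} (Φ : Distributor A B) (Ψ : Distributor B D) :
    Distributor A D where
  elem x z := ⨆ y, Φ.elem x y ≫ Ψ.elem y z
  left_le x' x z := by
    rw [comp_iSup]
    refine iSup_mono fun y => ?_
    rw [← Category.assoc]
    exact comp_mono (Φ.left_le x' x y) le_rfl
  right_le x z z' := by
    rw [iSup_comp]
    refine iSup_mono fun y => ?_
    rw [Category.assoc]
    exact comp_mono le_rfl (Ψ.right_le y z z')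

theorem Distributor.id_comp {A B : EnrichedCat Q} (Φ : Distributor A B) :
    (Distributor.id A).comp Φ = Φ := by
  ext x y
  apply le_antisymm
  · exact iSup_le fun x' => Φ.left_le x x' y
  · refine le_iSup_of_le x ?_
    exact (Category.id_comp (Φ.elem x y)).symm.le.trans (comp_mono (A.id_le x) le_rfl)

theorem Distributor.comp_id {A B : EnrichedCat Q} (Φ : Distributor A B) :
    Φ.comp (Distributor.id B) = Φ := by
  ext x y
  apply le_antisymm
  · exact iSup_le fun y' => Φ.right_le x y' y
  · refine le_iSup_of_le y ?_
    exact (Category.comp_id (Φ.elem x y)).symm.le.trans (comp_mono le_rfl (B.id_le y))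

theorem Distributor.assoc {A B D E : EnrichedCat Q} (Φ : Distributor A B) (Ψ : Distributor B D)
    (Θ : Distributor D E) : (Φ.comp Ψ).comp Θ = Φ.comp (Ψ.comp Θ) := by
  ext x w
  simp only [Distributor.comp, iSup_comp, comp_iSup, Category.assoc]
  rw [iSup_comm]

/-- Distributors are compared elementwise. -/
instance (A B : EnrichedCat Q) : PartialOrder (Distributor A B) :=
  PartialOrder.lift Distributor.elem fun _ _ => Distributor.ext

/-- Suprema of distributors are elementwise. -/
instance (A B : EnrichedCat Q) : SupSet (Distributor A B) where
  sSup S :=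
    { elem := fun x y => ⨆ Φ ∈ S, Φ.elem x y
      left_le := fun x' x y => by
        simp only [comp_iSup]
        exact iSup₂_mono fun Φ _ => Φ.left_le x' x y
      right_le := fun x y y' => by
        simp only [iSup_comp]
        exact iSup₂_mono fun Φ _ => Φ.right_le x y y' }

instance (A B : EnrichedCat Q) : CompleteLattice (Distributor A B) :=
  completeLatticeOfSup _ fun S => by
    constructor
    · intro Φ hΦ x y
      exact le_iSup₂_of_le (f := fun (Φ : Distributor A B) (_ : Φ ∈ S) => Φ.elem x y) Φ hΦ le_rfl
    · intro Ψ hΨ x y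
      exact iSup₂_le fun Φ hΦ => hΨ hΦ x y

theorem Distributor.sSup_elem {A B : EnrichedCat Q} (S : Set (Distributor A B)) (x : A.carrier)
    (y : B.carrier) : (sSup S).elem x y = ⨆ Φ ∈ S, Φ.elem x y := rfl

theorem Distributor.iSup_elem {A B : EnrichedCat Q} {ι : Sort*} (Φ : ι → Distributor A B)
    (x : A.carrier) (y : B.carrier) : (⨆ i, Φ i).elem x y = ⨆ i, (Φ i).elem x y := by
  rw [iSup, Distributor.sSup_elem, iSup_range]

theorem Distributor.sSup_comp {A B D : EnrichedCat Q} (S : Set (Distributor A B))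
    (Ψ : Distributor B D) : (sSup S).comp Ψ = ⨆ Φ ∈ S, Φ.comp Ψ := by
  ext x z
  simp only [Distributor.comp, Distributor.sSup_elem, Distributor.iSup_elem, iSup_comp]
  rw [iSup_comm]
  refine iSup_congr fun Φ => ?_
  rw [iSup_comm]

theorem Distributor.comp_sSup {A B D : EnrichedCat Q} (Φ : Distributor A B)
    (S : Set (Distributor B D)) : Φ.comp (sSup S) = ⨆ Ψ ∈ S, Φ.comp Ψ := by
  ext x z
  simp only [Distributor.comp, Distributor.sSup_elem, Distributor.iSup_elem, comp_iSup]
  rw [iSup_comm]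
  refine iSup_congr fun Φ => ?_
  rw [iSup_comm]

end

/-- An object of `SymDist Q`: a symmetric `Q`-category. -/
structure SymDist (Q : Type u) [SmallCategory Q] [Quantaloid Q] [InvolutiveQuantaloid Q] extends
    EnrichedCat Q where
  symm : ∀ x y : carrier, hom x y = (hom y x)ᵒ

variable {Q : Type u} [SmallCategory Q] [Quantaloid Q] [InvolutiveQuantaloid Q]

/-- The morphisms of `SymDist Q` are all distributors between symmetric `Q`-categories. -/
instance : Category.{u} (SymDist Q) where
  Hom A B := Distributor A.toEnrichedCat B.toEnrichedCat
  id A := Distributor.id A.toEnrichedCat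
  comp Φ Ψ := Φ.comp Ψ
  id_comp := Distributor.id_comp
  comp_id := Distributor.comp_id
  assoc := Distributor.assoc

instance : Quantaloid (SymDist Q) where
  homLattice A B := inferInstanceAs (CompleteLattice (Distributor A.toEnrichedCat B.toEnrichedCat))
  sSup_comp := Distributor.sSup_comp
  comp_sSup := Distributor.comp_sSup

/-- The involute of a distributor is computed elementwise. -/
instance : InvolutiveQuantaloid (SymDist Q) where
  inv {A B} Φ :=
    { elem := fun y x => (Φ.elem x y)ᵒ
      left_le := fun y' y x => by
        rw [B.symm, ← InvolutiveQuantaloid.inv_comp]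
        exact inv_mono (Φ.right_le x y y')
      right_le := fun y x x' => by
        rw [A.symm, ← InvolutiveQuantaloid.inv_comp]
        exact inv_mono (Φ.left_le x' x y) }
  inv_inv Φ := Distributor.ext (by
    funext x y
    exact InvolutiveQuantaloid.inv_inv _)
  inv_id A := Distributor.ext (by
    funext x y
    exact (A.symm x y).symm)
  inv_comp Φ Ψ := Distributor.ext (by
    funext x y
    change (⨆ z, Φ.elem y z ≫ Ψ.elem z x)ᵒ = ⨆ z, (Ψ.elem z x)ᵒ ≫ (Φ.elem y z)ᵒ
    simp only [inv_iSup, InvolutiveQuantaloid.inv_comp])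
  inv_sSup S := Distributor.ext (by
    funext x y
    refine (inv_iSup _).trans ?_
    erw [Distributor.iSup_elem]
    refine iSup_congr fun Φ => ?_
    erw [Distributor.iSup_elem]
    rw [inv_iSup])

variable {R : Type u} [SmallCategory R] [Quantaloid R] [InvolutiveQuantaloid R]

/-- The symmetric `R`-category `F A` induced by a symmetric `Q`-category `A` and a homomorphism
`F : Q → R`. -/
def changeBaseObj (F : InvolutiveHom Q R) (A : SymDist Q) : SymDist R where
  carrier := A.carrier
  type x := F.obj (A.type x)
  hom x y := F.map (A.hom x y)
  id_le x := by
    rw [← F.map_id]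
    exact F.map_mono (A.id_le x)
  comp_le x y z := by
    rw [← F.map_comp]
    exact F.map_mono (A.comp_le x y z)
  symm x y := by
    rw [← F.map_inv, ← A.symm]

/-- The change of base homomorphism `SymDist Q → SymDist R` induced by a homomorphism of involutive
quantaloids `F : Q → R`; it applies `F` to all hom-arrows and all elements of distributors. -/
def changeBase (F : InvolutiveHom Q R) : InvolutiveHom (SymDist Q) (SymDist R) where
  obj A := changeBaseObj F A
  map {A B} Φ :=
    { elem := fun x y => F.map (Φ.elem x y)
      left_le := fun x' x y => by
        change F.map (A.hom x' x) ≫ F.map (Φ.elem x y) ≤ _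
        rw [← F.map_comp]
        exact F.map_mono (Φ.left_le x' x y)
      right_le := fun x y y' => by
        change F.map (Φ.elem x y) ≫ F.map (B.hom y y') ≤ _
        rw [← F.map_comp]
        exact F.map_mono (Φ.right_le x y y') }
  map_id A := rfl
  map_comp Φ Ψ := Distributor.ext (by
    funext x y
    change F.map (⨆ z, Φ.elem x z ≫ Ψ.elem z y) = ⨆ z, F.map (Φ.elem x z) ≫ F.map (Ψ.elem z y)
    simp only [F.map_iSup, F.map_comp])
  map_sSup S := Distributor.ext (by
    funext x y
    refine (F.map_iSup _).trans ?_
    erw [Distributor.iSup_elem]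
    refine iSup_congr fun Φ => ?_
    erw [Distributor.iSup_elem]
    rw [F.map_iSup]
    rfl)
  map_inv Φ := Distributor.ext (by
    funext x y
    exact F.map_inv _)

end SymDist

end QuantaloidTheory

open QuantaloidTheory

/-! Small quantaloids of closed cribles are recognised intrinsically: they are the small involutive
quantaloids that are locally localic, modular, and weakly tabular. Here a map is a morphism left
adjoint to its involute, and weak tabularity says that every morphism is the supremum of the `fᵒ ≫
g` below it with `f`, `g` maps.

Sufficiency (`isSmallQuantaloidOfClosedCribles_of_isModular`): make the maps into a site, a sieve
covering when the `sᵒ ≫ s` have supremum above `1`, and send `q` to the closed crible of spans of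
maps with `fᵒ ≫ g ≤ q`. The supremum of the `fᵒ ≫ g` in a crible is inverse to this. Everything
rests on `id_inf_comp_le_of_spans`, a substitute for pullbacks of maps, and on maps being discretely
ordered. Necessity: transposition makes closed cribles locally localic and modular; any homomorphism
to a modular quantaloid respects the canonical involution, so both properties transfer, and weak
tabularity is the canonical formula itself.

Local localicity and modularity pass elementwise to matrices, and then to the splitting because
modularity lets infima there be computed in the quantale. Weak tabularity of the splitting follows
from density of the embedding (`matrixEmbedding_isDense`): maps out of the objects `M_{1_W}` already
generate all morphisms.

The embedding is also fully faithful, and change of base along any dense fully faithful homomorphism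
is an equivalence (`changeBase_isEquivalence`). It is fully faithful because it acts on elements;
and a symmetric category `B` over the codomain is symmetrically isomorphic to the image of the
category of all maps from image objects into types of `B`, through the evaluation distributor. -/

namespace QuantaloidTheory

/-! ### Maps, modularity and tabularity in involutive quantaloids -/

section LocallyLocalic

variable {Q : Type u} [Category.{v} Q] [Quantaloid Q]

variable (Q) in
/-- Finite infima of parallel morphisms distribute over arbitrary suprema. -/
def IsLocallyLocalic : Prop :=
  ∀ ⦃X Y : Q⦄ (q : X ⟶ Y) (S : Set (X ⟶ Y)), q ⊓ sSup S ≤ ⨆ s ∈ S, q ⊓ s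

theorem IsLocallyLocalic.inf_iSup_le (hF : IsLocallyLocalic Q) {X Y : Q} {ι : Sort*} (q : X ⟶ Y)
    (s : ι → (X ⟶ Y)) : q ⊓ ⨆ i, s i ≤ ⨆ i, q ⊓ s i := by
  refine (hF q (Set.range s)).trans ?_
  rw [iSup_range]

end LocallyLocalic

section Maps

variable {Q : Type u} [Category.{v} Q] [Quantaloid Q] [InvolutiveQuantaloid Q]

theorem inv_le_inv_iff {X Y : Q} {f g : X ⟶ Y} : fᵒ ≤ gᵒ ↔ f ≤ g :=
  ⟨fun h => by simpa only [InvolutiveQuantaloid.inv_inv] using inv_mono h, inv_mono⟩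

theorem inv_le_iff {X Y : Q} {f : X ⟶ Y} {g : Y ⟶ X} : fᵒ ≤ g ↔ f ≤ gᵒ := by
  rw [← inv_le_inv_iff, InvolutiveQuantaloid.inv_inv]

theorem le_inv_iff {X Y : Q} {f : X ⟶ Y} {g : Y ⟶ X} : g ≤ fᵒ ↔ gᵒ ≤ f := by
  rw [← inv_le_inv_iff, InvolutiveQuantaloid.inv_inv]

theorem inv_inf {X Y : Q} (f g : X ⟶ Y) : (f ⊓ g)ᵒ = fᵒ ⊓ gᵒ :=
  le_antisymm (le_inf (inv_mono inf_le_left) (inv_mono inf_le_right))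
    (le_inv_iff.2 (le_inf (inv_le_iff.2 inf_le_left) (inv_le_iff.2 inf_le_right)))

/-- A (symmetric) map: a morphism that is left adjoint to its involute. -/
def IsMap {X Y : Q} (f : X ⟶ Y) : Prop := IsAdjointPair f (fᵒ)

theorem isMap_id (X : Q) : IsMap (𝟙 X) := by
  constructor <;> simp [InvolutiveQuantaloid.inv_id]

theorem IsMap.le_comp_inv_comp {X Y Z : Q} {f : X ⟶ Y} (hf : IsMap f) (q : X ⟶ Z) :
    q ≤ f ≫ fᵒ ≫ q := by
  simpa using comp_mono hf.1 (le_refl q)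

theorem IsMap.inv_comp_comp_le {X Y Z : Q} {f : X ⟶ Y} (hf : IsMap f) (q : Y ⟶ Z) :
    fᵒ ≫ f ≫ q ≤ q := by
  simpa using comp_mono hf.2 (le_refl q)

theorem IsMap.comp_inv_comp_le {X Y Z : Q} {f : X ⟶ Y} (hf : IsMap f) (q : Z ⟶ Y) :
    (q ≫ fᵒ) ≫ f ≤ q := by
  simpa using comp_mono (le_refl q) hf.2

theorem IsMap.le_comp_comp_inv {X Y Z : Q} {f : X ⟶ Y} (hf : IsMap f) (q : Z ⟶ X) :
    q ≤ (q ≫ f) ≫ fᵒ := by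
  simpa using comp_mono (le_refl q) hf.1

theorem IsMap.inv_comp_le_iff {X Y Z : Q} {f : X ⟶ Y} (hf : IsMap f) {q : X ⟶ Z} {r : Y ⟶ Z} :
    fᵒ ≫ q ≤ r ↔ q ≤ f ≫ r :=
  ⟨fun h => (hf.le_comp_inv_comp q).trans (comp_mono le_rfl h),
    fun h => (comp_mono le_rfl h).trans (hf.inv_comp_comp_le r)⟩

theorem IsMap.comp_le_iff {X Y Z : Q} {f : X ⟶ Y} (hf : IsMap f) {q : Z ⟶ X} {r : Z ⟶ Y} :
    q ≫ f ≤ r ↔ q ≤ r ≫ fᵒ :=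
  ⟨fun h => (hf.le_comp_comp_inv q).trans (comp_mono h le_rfl),
    fun h => (comp_mono h le_rfl).trans (hf.comp_inv_comp_le r)⟩

theorem IsMap.comp {X Y Z : Q} {f : X ⟶ Y} {g : Y ⟶ Z} (hf : IsMap f) (hg : IsMap g) :
    IsMap (f ≫ g) := by
  constructor
  · rw [InvolutiveQuantaloid.inv_comp, Category.assoc]
    exact hf.1.trans (comp_mono le_rfl (hg.le_comp_inv_comp _))
  · rw [InvolutiveQuantaloid.inv_comp, Category.assoc]
    exact (comp_mono le_rfl (hf.inv_comp_comp_le _)).trans hg.2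

/-- Maps are discretely ordered. -/
theorem IsMap.eq_of_le {X Y : Q} {f g : X ⟶ Y} (hf : IsMap f) (hg : IsMap g) (h : f ≤ g) :
    f = g :=
  le_antisymm h ((hf.le_comp_inv_comp g).trans
    ((comp_mono le_rfl (comp_mono (inv_mono h) le_rfl)).trans
      (by simpa using comp_mono (le_refl f) hg.2)))

/-- Transposing along the adjunctions turns `H` into an inequality between maps, and maps are
discretely ordered. Thus spans below `f ≫ hᵒ` yield commutative squares of maps. -/
theorem IsMap.comp_eq_of_inv_comp_le {W X V Y : Q} {s : W ⟶ X} {x : W ⟶ V} {f : X ⟶ Y}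
    {h : V ⟶ Y} (hs : IsMap s) (hx : IsMap x) (hf : IsMap f) (hh : IsMap h)
    (H : sᵒ ≫ x ≤ f ≫ hᵒ) : x ≫ h = s ≫ f := by
  refine (hx.comp hh).eq_of_le (hs.comp hf) ?_
  rwa [hh.comp_le_iff, Category.assoc, ← hs.inv_comp_le_iff]

variable (Q)

/-- Freyd's modular law. -/
def IsModular : Prop :=
  ∀ ⦃X Y Z : Q⦄ (f : X ⟶ Y) (g : Y ⟶ Z) (h : X ⟶ Z), (f ≫ g) ⊓ h ≤ f ≫ (g ⊓ fᵒ ≫ h)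

/-- Every morphism is the supremum of the morphisms `g ∘ fᵒ` below it with `f` and `g` maps. -/
def IsWeaklyTabular : Prop :=
  ∀ ⦃X Y : Q⦄ (q r : X ⟶ Y),
    (∀ ⦃W : Q⦄ (f : W ⟶ X) (g : W ⟶ Y), IsMap f → IsMap g → fᵒ ≫ g ≤ q → fᵒ ≫ g ≤ r) → q ≤ r

variable {Q}

theorem IsModular.comp_inf_le (hM : IsModular Q) {X Y Z : Q} (f : X ⟶ Y) (g : Y ⟶ Z)
    (h : X ⟶ Z) : (f ≫ g) ⊓ h ≤ (f ⊓ h ≫ gᵒ) ≫ g := by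
  rw [← inv_le_inv_iff]
  simpa only [inv_inf, InvolutiveQuantaloid.inv_comp, InvolutiveQuantaloid.inv_inv] using
    hM (gᵒ) (fᵒ) (hᵒ)

/-- Each form of the modular law shrinks one factor to its meet with the involute of the other. This
is how totality of a composite becomes totality of a single morphism. -/
theorem IsModular.id_inf_comp_le (hM : IsModular Q) {X Y : Q} (f : X ⟶ Y) (g : Y ⟶ X) :
    𝟙 X ⊓ f ≫ g ≤ (f ⊓ gᵒ) ≫ (f ⊓ gᵒ)ᵒ := by
  have h1 : 𝟙 X ⊓ f ≫ g ≤ f ≫ (g ⊓ fᵒ) := by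
    rw [inf_comm]
    simpa using hM f g (𝟙 X)
  have h2 : 𝟙 X ⊓ f ≫ (g ⊓ fᵒ) ≤ (f ⊓ gᵒ) ≫ (g ⊓ fᵒ) := by
    rw [inf_comm]
    refine (hM.comp_inf_le f (g ⊓ fᵒ) (𝟙 X)).trans (comp_mono ?_ le_rfl)
    rw [Category.id_comp, inv_inf, InvolutiveQuantaloid.inv_inv]
    exact inf_le_inf le_rfl inf_le_left
  rw [inv_inf, InvolutiveQuantaloid.inv_inv, inf_comm (fᵒ)]
  exact (le_inf inf_le_left h1).trans h2

/-- In a modular quantaloid, the right adjoint of a morphism is its involute. -/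
theorem IsModular.eq_inv_of_isAdjointPair (hM : IsModular Q) {X Y : Q} {f : X ⟶ Y} {g : Y ⟶ X}
    (h : IsAdjointPair f g) : g = fᵒ := by
  -- The unit of the adjunction makes `f ⊓ gᵒ` total; composing with it and using the counit gives
  -- both inequalities.
  have h1 : 𝟙 X ≤ (f ⊓ gᵒ) ≫ (f ⊓ gᵒ)ᵒ := by
    simpa [inf_eq_left.2 h.1] using hM.id_inf_comp_le f g
  have h2 : (f ⊓ gᵒ)ᵒ ≤ g := inv_le_iff.2 inf_le_right
  have h3 : f ≤ gᵒ := by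
    calc f = 𝟙 X ≫ f := by simp
      _ ≤ ((f ⊓ gᵒ) ≫ (f ⊓ gᵒ)ᵒ) ≫ f := comp_mono h1 le_rfl
      _ = (f ⊓ gᵒ) ≫ (f ⊓ gᵒ)ᵒ ≫ f := by simp
      _ ≤ gᵒ ≫ 𝟙 Y := comp_mono inf_le_right ((comp_mono h2 le_rfl).trans h.2)
      _ = gᵒ := by simp
  have h4 : g ≤ fᵒ := by
    calc g = g ≫ 𝟙 X := by simp
      _ ≤ g ≫ ((f ⊓ gᵒ) ≫ (f ⊓ gᵒ)ᵒ) := comp_mono le_rfl h1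
      _ = (g ≫ (f ⊓ gᵒ)) ≫ (f ⊓ gᵒ)ᵒ := by simp
      _ ≤ 𝟙 Y ≫ fᵒ :=
        comp_mono ((comp_mono le_rfl inf_le_left).trans h.2) (inv_mono inf_le_left)
      _ = fᵒ := by simp
  exact le_antisymm h4 (inv_le_iff.2 h3)

/-- The coreflexive part of `f ≫ hᵒ ≫ k ≫ gᵒ` is below the supremum of the `sᵒ ≫ s`, where `s` runs
through the maps into `W` along which the span `(f, g)` factors through the span `(h, k)`. -/
theorem id_inf_comp_le_of_spans (hF : IsLocallyLocalic Q) (hM : IsModular Q)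
    (hT : IsWeaklyTabular Q) {W V X Y : Q} {f : W ⟶ X} {g : W ⟶ Y} {h : V ⟶ X} {k : V ⟶ Y}
    (hf : IsMap f) (hg : IsMap g) (hh : IsMap h) (hk : IsMap k) {r : W ⟶ W}
    (H : ∀ ⦃U : Q⦄ (s : U ⟶ W) (x : U ⟶ V), IsMap s → IsMap x → s ≫ f = x ≫ h →
      s ≫ g = x ≫ k → sᵒ ≫ s ≤ r) :
    𝟙 W ⊓ f ≫ hᵒ ≫ k ≫ gᵒ ≤ r := by
  -- `p` plays the role of the pullback of the two spans: a span of maps below it equalises both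
  -- pairs of legs.
  set p : W ⟶ V := f ≫ hᵒ ⊓ g ≫ kᵒ with hp
  have h1 : 𝟙 W ⊓ f ≫ hᵒ ≫ k ≫ gᵒ ≤ p ≫ pᵒ := by
    have := hM.id_inf_comp_le (f ≫ hᵒ) (k ≫ gᵒ)
    rwa [InvolutiveQuantaloid.inv_comp, InvolutiveQuantaloid.inv_inv, Category.assoc, ← hp] at this
  have h2 : p = ⨆ a : {a : (U : Q) × (U ⟶ W) × (U ⟶ V) //
      IsMap a.2.1 ∧ IsMap a.2.2 ∧ a.2.1ᵒ ≫ a.2.2 ≤ p}, a.1.2.1ᵒ ≫ a.1.2.2 := by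
    refine le_antisymm (hT _ _ fun U s x hs hx hsx => ?_) (iSup_le fun a => a.2.2.2)
    exact le_iSup (fun a : {a : (U : Q) × (U ⟶ W) × (U ⟶ V) //
      IsMap a.2.1 ∧ IsMap a.2.2 ∧ a.2.1ᵒ ≫ a.2.2 ≤ p} => a.1.2.1ᵒ ≫ a.1.2.2)
      ⟨⟨U, s, x⟩, hs, hx, hsx⟩
  refine (le_inf inf_le_left h1).trans ?_
  -- Only the first factor `p` is to be expanded as a supremum; its involute stays opaque.
  generalize pᵒ = p' at *
  rw [h2, iSup_comp]
  refine (hF.inf_iSup_le _ _).trans (iSup_le fun ⟨⟨U, s, x⟩, hs, hx, hsx⟩ => ?_)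
  refine le_trans ?_ (H s x hs hx (hs.comp_eq_of_inv_comp_le hx hf hh (hsx.trans inf_le_left)).symm
    (hs.comp_eq_of_inv_comp_le hx hg hk (hsx.trans inf_le_right)).symm)
  change 𝟙 W ⊓ (sᵒ ≫ x) ≫ p' ≤ sᵒ ≫ s
  rw [inf_comm, Category.assoc]
  -- Modularity bounds the meet by `sᵒ ≫ (x ≫ p' ⊓ s)`, so `p'` disappears.
  refine (hM (sᵒ) (x ≫ p') (𝟙 W)).trans (comp_mono le_rfl ?_)
  rw [InvolutiveQuantaloid.inv_inv, Category.comp_id]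
  exact inf_le_right

end Maps

/-! ### The site of maps -/

section MapSite

/-- The objects of the category of maps of an involutive quantaloid `P`: the objects of `P`. -/
structure MapCat (P : Type u) where
  of :: obj : P

variable {P : Type u} [SmallCategory P] [Quantaloid P] [InvolutiveQuantaloid P]

instance : Category.{u} (MapCat P) where
  Hom X Y := {f : X.obj ⟶ Y.obj // IsMap f}
  id X := ⟨𝟙 X.obj, isMap_id X.obj⟩
  comp f g := ⟨f.1 ≫ g.1, f.2.comp g.2⟩
  id_comp f := Subtype.ext (Category.id_comp f.1)
  comp_id f := Subtype.ext (Category.comp_id f.1)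
  assoc f g h := Subtype.ext (Category.assoc f.1 g.1 h.1)

theorem MapCat.comp_val {X Y Z : MapCat P} (f : X ⟶ Y) (g : Y ⟶ Z) : (f ≫ g).1 = f.1 ≫ g.1 := rfl

theorem MapCat.id_val (X : MapCat P) : (𝟙 X : X ⟶ X).1 = 𝟙 X.obj := rfl

/-- A sieve on `X` covers if the supremum of the `s ∘ sᵒ`, for `s` in the sieve, is above `1`. -/
def IsCovering {X : MapCat P} (S : Sieve X) : Prop :=
  ∀ r : X.obj ⟶ X.obj, (∀ ⦃W : MapCat P⦄ (s : W ⟶ X), S s → s.1ᵒ ≫ s.1 ≤ r) → 𝟙 X.obj ≤ r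

/-- Insert `1 ≤ ⋁ sᵒ ≫ s` between `f` and `g`: an inequality of composites may be checked along a
cover. -/
theorem IsCovering.le_of_forall {X : MapCat P} {S : Sieve X} (hS : IsCovering S) {A B : P}
    {f : A ⟶ X.obj} {g : X.obj ⟶ B} {r : A ⟶ B}
    (H : ∀ ⦃W : MapCat P⦄ (s : W ⟶ X), S s → (f ≫ s.1ᵒ) ≫ s.1 ≫ g ≤ r) : f ≫ g ≤ r := by
  have h1 : 𝟙 X.obj ≤ sSup {p | ∃ (W : MapCat P) (s : W ⟶ X), S s ∧ p = s.1ᵒ ≫ s.1} :=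
    hS _ fun W s hs => le_sSup ⟨W, s, hs, rfl⟩
  calc f ≫ g = f ≫ 𝟙 X.obj ≫ g := by simp
    _ ≤ _ := comp_mono le_rfl (comp_mono h1 le_rfl)
    _ ≤ r := by
      rw [Quantaloid.sSup_comp]
      simp only [comp_iSup]
      refine iSup₂_le ?_
      rintro p ⟨W, s, hs, rfl⟩
      simpa using H s hs

/-- The topology of `IsCovering` sieves on the category of maps. -/
def mapTopology (hF : IsLocallyLocalic P) (hM : IsModular P) (hT : IsWeaklyTabular P) :
    GrothendieckTopology (MapCat P) where
  sieves X := {S | IsCovering S}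
  top_mem' X r h := by
    simpa [MapCat.id_val, InvolutiveQuantaloid.inv_id] using h (𝟙 X) trivial
  pullback_stable' X Y S f hS r h := by
    -- Since `1 ≤ f ≫ fᵒ`, the cover can be inserted between `f` and `fᵒ`; the span lemma for `(f,
    -- f)` and `(s, s)` then bounds each term by maps in the pulled-back sieve.
    have h1 : 𝟙 Y.obj ≤ 𝟙 Y.obj ⊓ ⨆ a : {a : (V : MapCat P) × (V ⟶ X) // S a.2},
        f.1 ≫ a.1.2.1ᵒ ≫ a.1.2.1 ≫ f.1ᵒ := by
      refine le_inf le_rfl (f.2.1.trans (IsCovering.le_of_forall hS fun V s hs => ?_))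
      rw [Category.assoc]
      exact le_iSup (fun a : {a : (V : MapCat P) × (V ⟶ X) // S a.2} =>
        f.1 ≫ a.1.2.1ᵒ ≫ a.1.2.1 ≫ f.1ᵒ) ⟨⟨V, s⟩, hs⟩
    refine h1.trans ((hF.inf_iSup_le _ _).trans (iSup_le fun ⟨⟨V, s⟩, hs⟩ => ?_))
    refine id_inf_comp_le_of_spans hF hM hT f.2 f.2 s.2 s.2 fun U t x ht hx e _ => ?_
    refine h (W := MapCat.of U) ⟨t, ht⟩ ?_
    have e' : (⟨t, ht⟩ : MapCat.of U ⟶ Y) ≫ f = (⟨x, hx⟩ : MapCat.of U ⟶ V) ≫ s := Subtype.ext e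
    change S ((⟨t, ht⟩ : MapCat.of U ⟶ Y) ≫ f)
    rw [e']
    exact S.downward_closed hs _
  transitive' X S hS R hR r h := by
    refine hS _ fun W s hs => ?_
    refine IsCovering.le_of_forall (hR hs) fun V t ht => ?_
    refine le_trans (le_of_eq ?_) (h _ ht)
    simp [MapCat.comp_val, InvolutiveQuantaloid.inv_comp]

/-! ### Morphisms as closed cribles on the site of maps -/

variable (hF : IsLocallyLocalic P) (hM : IsModular P) (hT : IsWeaklyTabular P)

/-- The closed crible of all spans `(f, g)` of maps such that `g ∘ fᵒ ≤ q`. -/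
def spanCrible {X Y : P} (q : X ⟶ Y) :
    ClosedCrible (mapTopology hF hM hT) (MapCat.of X) (MapCat.of Y) where
  rel f g := f.1ᵒ ≫ g.1 ≤ q
  precomp t f g h := by
    refine le_trans ?_ h
    rw [MapCat.comp_val, MapCat.comp_val, InvolutiveQuantaloid.inv_comp, Category.assoc]
    exact comp_mono le_rfl (t.2.inv_comp_comp_le _)
  closed f g h := by
    refine IsCovering.le_of_forall (S := Crible.sieve _ f g) h fun V t ht => ?_
    refine le_trans (le_of_eq ?_) ht
    simp [MapCat.comp_val, InvolutiveQuantaloid.inv_comp]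

variable {hF hM hT}

/-- The supremum of the morphisms `g ∘ fᵒ` for `(f, g)` in a crible. -/
def Crible.join {X Y : P} (R : Crible (MapCat.of X) (MapCat.of Y)) : X ⟶ Y :=
  sSup {q | ∃ (W : MapCat P) (f : W ⟶ MapCat.of X) (g : W ⟶ MapCat.of Y),
    R.rel f g ∧ q = f.1ᵒ ≫ g.1}

theorem Crible.le_join {X Y : P} {R : Crible (MapCat.of X) (MapCat.of Y)} {W : MapCat P}
    {f : W ⟶ MapCat.of X} {g : W ⟶ MapCat.of Y} (h : R.rel f g) : f.1ᵒ ≫ g.1 ≤ R.join :=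
  le_sSup ⟨W, f, g, h, rfl⟩

/-- The hypothesis transposes to `1 ≤ f ≫ R.join ≫ gᵒ`. Expanding the join, the span lemma covers
`W` by maps along which `(f, g)` factors through members of `R`, and `R` is closed. -/
theorem ClosedCrible.rel_of_le_join {X Y : P}
    (R : ClosedCrible (mapTopology hF hM hT) (MapCat.of X) (MapCat.of Y)) {W : MapCat P}
    {f : W ⟶ MapCat.of X} {g : W ⟶ MapCat.of Y} (h : f.1ᵒ ≫ g.1 ≤ R.join) : R.rel f g := by
  refine R.closed f g fun r H => ?_
  have h1 : 𝟙 W.obj ≤ f.1 ≫ R.join ≫ g.1ᵒ := by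
    rw [← Category.assoc, ← g.2.comp_le_iff, Category.id_comp]
    exact f.2.inv_comp_le_iff.1 h
  have h2 : f.1 ≫ R.join ≫ g.1ᵒ ≤ ⨆ a : {a : (V : MapCat P) × (V ⟶ MapCat.of X) ×
      (V ⟶ MapCat.of Y) // R.rel a.2.1 a.2.2}, f.1 ≫ a.1.2.1.1ᵒ ≫ a.1.2.2.1 ≫ g.1ᵒ := by
    rw [Crible.join, Quantaloid.sSup_comp]
    simp only [comp_iSup]
    refine iSup₂_le ?_
    rintro p ⟨V, h, k, hR, rfl⟩
    rw [Category.assoc]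
    exact le_iSup (fun a : {a : (V : MapCat P) × (V ⟶ MapCat.of X) ×
      (V ⟶ MapCat.of Y) // R.rel a.2.1 a.2.2} => f.1 ≫ a.1.2.1.1ᵒ ≫ a.1.2.2.1 ≫ g.1ᵒ)
      ⟨⟨V, h, k⟩, hR⟩
  refine (le_inf le_rfl (h1.trans h2)).trans ((hF.inf_iSup_le _ _).trans
    (iSup_le fun ⟨⟨V, h, k⟩, hR⟩ => ?_))
  refine id_inf_comp_le_of_spans hF hM hT f.2 g.2 h.2 k.2 fun U s x hs hx e e' => ?_
  refine H (W := MapCat.of U) ⟨s, hs⟩ ?_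
  have i : (⟨s, hs⟩ : MapCat.of U ⟶ W) ≫ f = (⟨x, hx⟩ : MapCat.of U ⟶ V) ≫ h := Subtype.ext e
  have i' : (⟨s, hs⟩ : MapCat.of U ⟶ W) ≫ g = (⟨x, hx⟩ : MapCat.of U ⟶ V) ≫ k := Subtype.ext e'
  change R.rel ((⟨s, hs⟩ : MapCat.of U ⟶ W) ≫ f) ((⟨s, hs⟩ : MapCat.of U ⟶ W) ≫ g)
  rw [i, i']
  exact R.precomp _ hR

theorem ClosedCrible.spanCrible_join {X Y : P}
    (R : ClosedCrible (mapTopology hF hM hT) (MapCat.of X) (MapCat.of Y)) :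
    spanCrible hF hM hT R.join = R :=
  ClosedCrible.ext_iff' fun _ _ => ⟨R.rel_of_le_join, Crible.le_join⟩

/-- From right to left this is weak tabularity: only spans of maps below `q` need testing. -/
theorem le_join_iff {X Y : P} (q : X ⟶ Y)
    (R : ClosedCrible (mapTopology hF hM hT) (MapCat.of X) (MapCat.of Y)) :
    q ≤ R.join ↔ spanCrible hF hM hT q ≤ R :=
  ⟨fun h _ _ _ hfg => R.rel_of_le_join (le_trans hfg h),
    fun h => hT _ _ fun W f g hf hg hfg =>
      Crible.le_join (W := MapCat.of W) (f := ⟨f, hf⟩) (g := ⟨g, hg⟩) (h _ _ hfg)⟩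

theorem spanCrible_mono {X Y : P} {q r : X ⟶ Y} (h : q ≤ r) :
    spanCrible hF hM hT q ≤ spanCrible hF hM hT r :=
  fun _ _ _ hfg => le_trans hfg h

theorem join_spanCrible {X Y : P} (q : X ⟶ Y) : (spanCrible hF hM hT q).join = q := by
  refine le_antisymm (sSup_le ?_) ((le_join_iff _ _).2 le_rfl)
  rintro _ ⟨W, f, g, h, rfl⟩
  exact h

/-- For maps, `fᵒ ≫ g ≤ 1` transposes to `g ≤ f`, hence `f = g` by discreteness. -/
theorem spanCrible_id (X : P) :
    spanCrible hF hM hT (𝟙 X) = (Crible.diag (MapCat.of X)).closure _ := by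
  refine le_antisymm (fun W f g h => Crible.le_closure _ ?_)
    (fun W f g h => Crible.closure_le _ _ (fun f g h => ?_) h)
  · change f = g
    have := f.2.inv_comp_le_iff.1 h
    rw [Category.comp_id] at this
    exact (Subtype.ext (g.2.eq_of_le f.2 this)).symm
  · change f = g at h
    subst h
    exact f.2.2

theorem spanCrible_comp {X Y Z : P} (q : X ⟶ Y) (r : Y ⟶ Z) :
    spanCrible hF hM hT (q ≫ r) = (spanCrible hF hM hT q).comp (spanCrible hF hM hT r) := by
  refine le_antisymm ?_ (ClosedCrible.comp_le fun f g k h1 h2 => ?_)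
  · rw [← le_join_iff]
    nth_rw 1 [← join_spanCrible (hF := hF) (hM := hM) (hT := hT) q,
      ← join_spanCrible (hF := hF) (hM := hM) (hT := hT) r]
    rw [Crible.join, Quantaloid.sSup_comp]
    refine iSup₂_le ?_
    rintro _ ⟨W, a, b, hab, rfl⟩
    rw [Crible.join, Quantaloid.comp_sSup]
    refine iSup₂_le ?_
    rintro _ ⟨V, c, d, hcd, rfl⟩
    -- Moving the outer legs across isolates `b ≫ cᵒ`. The spans of maps below it are commutative
    -- squares over `b` and `c`, which supply the common middle leg required by relational
    -- composition.
    rw [Category.assoc, a.2.inv_comp_le_iff, ← Category.assoc, d.2.comp_le_iff]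
    refine hT _ _ fun U m n hm hn hmn => ?_
    rw [← d.2.comp_le_iff, Category.assoc, hm.inv_comp_le_iff, ← Category.assoc m,
      ← (hm.comp a.2).inv_comp_le_iff]
    have e : n ≫ c.1 = m ≫ b.1 := hm.comp_eq_of_inv_comp_le hn b.2 c.2 hmn
    have e' : (⟨n, hn⟩ : MapCat.of U ⟶ V) ≫ c = (⟨m, hm⟩ : MapCat.of U ⟶ W) ≫ b := Subtype.ext e
    refine Crible.le_join (f := (⟨m, hm⟩ : MapCat.of U ⟶ W) ≫ a)
      (g := (⟨n, hn⟩ : MapCat.of U ⟶ V) ≫ d)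
      (ClosedCrible.rel_comp (g := (⟨m, hm⟩ : MapCat.of U ⟶ W) ≫ b)
        ((spanCrible hF hM hT q).precomp _ hab) ?_)
    rw [← e']
    exact (spanCrible hF hM hT r).precomp _ hcd
  · refine le_trans ?_ (comp_mono h1 h2)
    rw [Category.assoc]
    exact comp_mono le_rfl (g.2.le_comp_inv_comp _)

variable (hF hM hT)

/-- The comparison homomorphism from `P` to the closed cribles on its site of maps. -/
def spanFunctor : P ⥤ ClosedCribles (mapTopology hF hM hT) where
  obj X := ClosedCribles.of (MapCat.of X)
  map q := spanCrible hF hM hT q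
  map_id X := spanCrible_id X
  map_comp q r := spanCrible_comp q r

/-- By `le_join_iff` the functor is, on homs, left adjoint to taking joins. -/
theorem spanFunctor_isHomomorphism : IsHomomorphism (spanFunctor hF hM hT) := by
  intro X Y S
  apply le_antisymm
  · refine (le_join_iff _ _).1 (sSup_le fun q hq => (le_join_iff _ _).2 ?_)
    exact le_iSup₂ (f := fun q (_ : q ∈ S) => (spanFunctor hF hM hT).map q) q hq
  · exact iSup₂_le fun q hq => spanCrible_mono (le_sSup hq)

instance : (spanFunctor hF hM hT).IsEquivalence where
  faithful := ⟨fun {X Y q r} h => by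
    have h' : spanCrible hF hM hT q = spanCrible hF hM hT r := h
    rw [← join_spanCrible (hF := hF) (hM := hM) (hT := hT) q, h', join_spanCrible]⟩
  full := ⟨fun {X Y} R => ⟨Crible.join (X := X) (Y := Y) (ClosedCrible.toCrible R),
    ClosedCrible.spanCrible_join (X := X) (Y := Y) R⟩⟩
  essSurj := ⟨fun X => ⟨X.obj.obj, ⟨Iso.refl _⟩⟩⟩

end MapSite

/-- A locally localic, modular and weakly tabular small involutive quantaloid is a small quantaloid
of closed cribles. -/
theorem isSmallQuantaloidOfClosedCribles_of_isModular {P : Type u} [SmallCategory P]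
    [Quantaloid P] [InvolutiveQuantaloid P] (hF : IsLocallyLocalic P) (hM : IsModular P)
    (hT : IsWeaklyTabular P) :
    IsSmallQuantaloidOfClosedCribles P where
  exists_site := ⟨MapCat P, inferInstance, mapTopology hF hM hT, spanFunctor hF hM hT,
    spanFunctor_isHomomorphism hF hM hT, inferInstance⟩
  -- Modularity forces right adjoints to be involutes, so the canonical formula is weak tabularity
  -- read through the involution.
  inv_eq {Y X} q := by
    apply le_antisymm
    · rw [inv_le_iff]
      refine hT _ _ fun W g f hg hf h => ?_
      rw [← inv_le_iff, InvolutiveQuantaloid.inv_comp, InvolutiveQuantaloid.inv_inv]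
      exact le_sSup ⟨W, f, fᵒ, g, gᵒ, hf, hg, h, rfl⟩
    · refine sSup_le ?_
      rintro p ⟨W, f, f', g, g', hf, hg, h, rfl⟩
      rw [le_inv_iff]
      rw [hM.eq_inv_of_isAdjointPair hg] at h
      rwa [hM.eq_inv_of_isAdjointPair hf, InvolutiveQuantaloid.inv_comp,
        InvolutiveQuantaloid.inv_inv]

/-! ### Closed cribles are locally localic and modular -/

section ClosedCribles

variable {C : Type u} [SmallCategory C] {J : GrothendieckTopology C}

/-- The transpose of a closed crible. -/
def ClosedCrible.transpose {X Y : C} (R : ClosedCrible J X Y) : ClosedCrible J Y X where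
  rel f g := R.rel g f
  precomp t _ _ h := R.precomp t h
  closed f g h := R.closed g f h

theorem ClosedCrible.transpose_mono {X Y : C} {R S : ClosedCrible J X Y} (h : R ≤ S) :
    R.transpose ≤ S.transpose :=
  fun _ f g hfg => h g f hfg

/-- The intersection of two closed cribles. -/
def ClosedCrible.inter {X Y : C} (R S : ClosedCrible J X Y) : ClosedCrible J X Y where
  rel f g := R.rel f g ∧ S.rel f g
  precomp t _ _ h := ⟨R.precomp t h.1, S.precomp t h.2⟩
  closed f g h := ⟨R.closed f g (J.superset_covering (fun _ _ (ht : R.rel _ _ ∧ S.rel _ _) => ht.1) h),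
    S.closed f g (J.superset_covering (fun _ _ (ht : R.rel _ _ ∧ S.rel _ _) => ht.2) h)⟩

theorem ClosedCrible.inf_eq_inter {X Y : C} (R S : ClosedCrible J X Y) : R ⊓ S = R.inter S :=
  le_antisymm (fun _ f g h => ⟨(inf_le_left : R ⊓ S ≤ R) f g h, (inf_le_right : R ⊓ S ≤ S) f g h⟩)
    (le_inf (fun _ _ _ h => h.1) (fun _ _ _ h => h.2))

theorem ClosedCrible.transpose_comp {X Y Z : C} (R : ClosedCrible J X Y)
    (S : ClosedCrible J Y Z) : (R.comp S).transpose = S.transpose.comp R.transpose := by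
  apply le_antisymm
  · exact ClosedCrible.transpose_mono (S := (S.transpose.comp R.transpose).transpose)
      (ClosedCrible.comp_le fun f g k h1 h2 => ClosedCrible.rel_comp (R := S.transpose) h2 h1)
  · exact ClosedCrible.comp_le fun f g k h1 h2 => ClosedCrible.rel_comp (R := R) h2 h1

/-- The involution on closed cribles is transposition. -/
instance : InvolutiveQuantaloid (ClosedCribles J) where
  inv {X Y} R := ClosedCrible.transpose (X := X.obj) (Y := Y.obj) R
  inv_inv R := rfl
  inv_id X := by
    have key : ((Crible.diag X.obj).closure J).transpose ≤ (Crible.diag X.obj).closure J :=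
      fun W f g h => Crible.closure_le (Crible.diag X.obj) ((Crible.diag X.obj).closure J).transpose
        (fun f g h => Crible.le_closure _ (Eq.symm h)) h
    exact le_antisymm key (ClosedCrible.transpose_mono key)
  inv_comp R S := ClosedCrible.transpose_comp R S
  inv_sSup {X Y} S := by
    apply le_antisymm
    · have : sSup S ≤ ClosedCrible.transpose (X := Y.obj) (Y := X.obj)
          (⨆ R ∈ S, ClosedCrible.transpose (X := X.obj) (Y := Y.obj) R) :=
        sSup_le fun R hR => ClosedCrible.transpose_mono (le_iSup₂ (f := fun (R : X ⟶ Y)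
          (_ : R ∈ S) => ClosedCrible.transpose (X := X.obj) (Y := Y.obj) R) R hR)
      exact ClosedCrible.transpose_mono this
    · exact iSup₂_le (α := Y ⟶ X) fun R hR => ClosedCrible.transpose_mono (le_sSup hR)

/-- Infima are intersections, and belonging to a supremum means belonging locally to a member. -/
theorem ClosedCribles.isLocallyLocalic : IsLocallyLocalic (ClosedCribles J) := by
  intro X Y R S
  refine (ClosedCrible.inf_eq_inter (X := X.obj) (Y := Y.obj) R (sSup S)).le.trans ?_
  rintro W f g ⟨h1, h2⟩
  refine ClosedCrible.closed _ f g (J.superset_covering (fun V t ht => ?_) h2)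
  obtain ⟨T, hT, ht⟩ := ht
  refine (le_iSup₂ (f := fun (T : X ⟶ Y) (_ : T ∈ S) => R ⊓ T) T hT) _ _ ?_
  exact (ClosedCrible.inf_eq_inter (X := X.obj) (Y := Y.obj) R T).ge _ _ ⟨R.precomp t h1, ht⟩

/-- Locally there is a middle leg `g` with `(f, g)` in `R` and `(g, k)` in `S`; then `(g, f)` and
`(f, k)` witness `(g, k)` in `Rᵒ ≫ T`. -/
theorem ClosedCribles.isModular : IsModular (ClosedCribles J) := by
  intro X Y Z R S T
  refine (ClosedCrible.inf_eq_inter (X := X.obj) (Y := Z.obj) (R ≫ S) T).le.trans ?_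
  rintro W f k ⟨h1, h2⟩
  refine ClosedCrible.closed _ f k (J.superset_covering (fun V t ht => ?_) h1)
  obtain ⟨g, hg, hg'⟩ := ht
  refine ClosedCrible.rel_comp hg ?_
  refine (ClosedCrible.inf_eq_inter (X := Y.obj) (Y := Z.obj) S _).ge _ _ ⟨hg', ?_⟩
  exact ClosedCrible.rel_comp (R := ClosedCrible.transpose (X := X.obj) (Y := Y.obj) R) hg
    (T.precomp t h2)

end ClosedCribles

/-! ### Transport along homomorphisms -/

section Transport

variable {Q : Type u} [Category.{v} Q] [Quantaloid Q]
  {R : Type u'} [Category.{v'} R] [Quantaloid R] {F : Q ⥤ R}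

theorem IsHomomorphism.map_iSup (hF : IsHomomorphism F) {ι : Sort*} {X Y : Q} (f : ι → (X ⟶ Y)) :
    F.map (⨆ i, f i) = ⨆ i, F.map (f i) := by
  rw [iSup, hF, iSup_range]

theorem IsHomomorphism.map_mono (hF : IsHomomorphism F) {X Y : Q} {f g : X ⟶ Y} (h : f ≤ g) :
    F.map f ≤ F.map g := by
  have : g = sSup {f, g} := by rw [sSup_pair, sup_eq_right.2 h]
  rw [this, hF]
  exact le_iSup₂_of_le f (by simp) le_rfl

/-- The order is encoded by suprema: `f ≤ g` exactly when `sSup {f, g} = g`, an equation that `F`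
preserves and reflects. -/
theorem IsHomomorphism.map_le_map_iff (hF : IsHomomorphism F) [F.Faithful] {X Y : Q}
    {f g : X ⟶ Y} : F.map f ≤ F.map g ↔ f ≤ g := by
  refine ⟨fun h => ?_, hF.map_mono⟩
  have : F.map (sSup {f, g}) = F.map g := by
    rw [hF, iSup_pair, sup_eq_right.2 h]
  rw [← F.map_injective this]
  exact le_sSup (by simp)

theorem IsHomomorphism.map_inf (hF : IsHomomorphism F) [F.Faithful] [F.Full] {X Y : Q}
    (f g : X ⟶ Y) : F.map (f ⊓ g) = F.map f ⊓ F.map g := by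
  refine le_antisymm (le_inf (hF.map_mono inf_le_left) (hF.map_mono inf_le_right)) ?_
  obtain ⟨h, e⟩ := F.map_surjective (F.map f ⊓ F.map g)
  rw [← e]
  exact hF.map_mono (le_inf (hF.map_le_map_iff.1 (e.le.trans inf_le_left))
    (hF.map_le_map_iff.1 (e.le.trans inf_le_right)))

theorem IsHomomorphism.map_isAdjointPair (hF : IsHomomorphism F) {X Y : Q} {f : X ⟶ Y} {g : Y ⟶ X}
    (h : IsAdjointPair f g) : IsAdjointPair (F.map f) (F.map g) := by
  constructor
  · rw [← F.map_id, ← F.map_comp]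
    exact hF.map_mono h.1
  · rw [← F.map_id, ← F.map_comp]
    exact hF.map_mono h.2

theorem IsHomomorphism.isLocallyLocalic (hF : IsHomomorphism F) [F.Faithful] [F.Full]
    (hR : IsLocallyLocalic R) : IsLocallyLocalic Q := by
  intro X Y q S
  rw [← hF.map_le_map_iff, hF.map_inf, hF, hF.map_iSup]
  refine (hR.inf_iSup_le _ _).trans (iSup_mono fun s => ?_)
  rw [hF.map_iSup]
  refine (hR.inf_iSup_le _ _).trans (iSup_mono fun hs => ?_)
  rw [hF.map_inf]

theorem IsHomomorphism.isModular [InvolutiveQuantaloid Q] [InvolutiveQuantaloid R]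
    (hF : IsHomomorphism F) [F.Faithful] [F.Full] (hi : ∀ {X Y : Q} (f : X ⟶ Y),
      F.map (fᵒ) = (F.map f)ᵒ) (hR : IsModular R) : IsModular Q := by
  intro X Y Z f g h
  rw [← hF.map_le_map_iff, hF.map_inf, F.map_comp, F.map_comp, hF.map_inf, F.map_comp, hi]
  exact hR _ _ _

end Transport

/-! ### Small quantaloids of closed cribles are locally localic, modular and weakly tabular -/

namespace IsSmallQuantaloidOfClosedCribles

variable {Q : Type u} [SmallCategory Q] [Quantaloid Q] [InvolutiveQuantaloid Q]

/-- Identities as one leg in the canonical formula give `f' ≤ fᵒ` and `f ≤ f'ᵒ`. Only the formula is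
used, not modularity, which is yet to be transported. -/
theorem eq_inv_of_isAdjointPair (hQ : IsSmallQuantaloidOfClosedCribles Q) {X Y : Q} {f : X ⟶ Y}
    {f' : Y ⟶ X} (h : IsAdjointPair f f') : f' = fᵒ := by
  have hid : ∀ Z : Q, IsAdjointPair (𝟙 Z) (𝟙 Z) := fun Z => by constructor <;> simp
  apply le_antisymm
  · rw [hQ.inv_eq f]
    exact le_sSup ⟨X, f, f', 𝟙 X, 𝟙 X, h, hid X, by simp, by simp⟩
  · rw [inv_le_iff, hQ.inv_eq f']
    exact le_sSup ⟨X, 𝟙 X, 𝟙 X, f, f', hid X, h, by simp, by simp⟩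

/-- All left adjoints are maps, so the canonical formula for `qᵒ` is the required supremum,
transposed. -/
theorem isWeaklyTabular (hQ : IsSmallQuantaloidOfClosedCribles Q) : IsWeaklyTabular Q := by
  intro X Y q r H
  rw [← inv_le_inv_iff, hQ.inv_eq q]
  refine sSup_le ?_
  rintro p ⟨W, g, g', f, f', hg, hf, h, rfl⟩
  have eg := hQ.eq_inv_of_isAdjointPair hg
  have ef := hQ.eq_inv_of_isAdjointPair hf
  subst eg ef
  rw [le_inv_iff, InvolutiveQuantaloid.inv_comp, InvolutiveQuantaloid.inv_inv]
  exact H f g hf hg h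

/-- The canonical involution is built from adjoints, composites and suprema, which homomorphisms
preserve; in `R` right adjoints are involutes. One inequality suffices, applied to `q` and `qᵒ`. -/
theorem map_inv (hQ : IsSmallQuantaloidOfClosedCribles Q) {R : Type u'} [Category.{v'} R]
    [Quantaloid R] [InvolutiveQuantaloid R] (hR : IsModular R) {F : Q ⥤ R} (hF : IsHomomorphism F)
    {X Y : Q} (q : X ⟶ Y) : F.map (qᵒ) = (F.map q)ᵒ := by
  have key : ∀ {X Y : Q} (q : X ⟶ Y), F.map (qᵒ) ≤ (F.map q)ᵒ := by
    intro X Y q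
    rw [hQ.inv_eq, hF]
    refine iSup₂_le ?_
    rintro p ⟨W, f, f', g, g', hf, hg, h, rfl⟩
    rw [le_inv_iff, F.map_comp, InvolutiveQuantaloid.inv_comp,
      ← hR.eq_inv_of_isAdjointPair (hF.map_isAdjointPair hg),
      hR.eq_inv_of_isAdjointPair (hF.map_isAdjointPair hf), InvolutiveQuantaloid.inv_inv,
      ← F.map_comp]
    exact hF.map_mono h
  refine le_antisymm (key q) ?_
  rw [inv_le_iff]
  simpa only [InvolutiveQuantaloid.inv_inv] using key (qᵒ)

theorem isLocallyLocalic (hQ : IsSmallQuantaloidOfClosedCribles Q) : IsLocallyLocalic Q := by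
  obtain ⟨C, _, J, F, hF, _⟩ := hQ.exists_site
  exact hF.isLocallyLocalic ClosedCribles.isLocallyLocalic

theorem isModular (hQ : IsSmallQuantaloidOfClosedCribles Q) : IsModular Q := by
  obtain ⟨C, _, J, F, hF, _⟩ := hQ.exists_site
  exact hF.isModular (hQ.map_inv ClosedCribles.isModular hF) ClosedCribles.isModular

end IsSmallQuantaloidOfClosedCribles

/-! ### Matrices -/

section Matrices

variable {Q : Type u} [SmallCategory Q] [Quantaloid Q]

theorem Matr.inf_apply {A B : Matr Q} (M N : A ⟶ B) (a : A.carrier) (b : B.carrier) :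
    (M ⊓ N) a b = M a b ⊓ N a b := rfl

theorem Matr.isLocallyLocalic (hF : IsLocallyLocalic Q) : IsLocallyLocalic (Matr Q) := by
  intro A B M S a b
  rw [Matr.inf_apply, Matr.sSup_apply', Matr.iSup_apply']
  refine (hF.inf_iSup_le _ _).trans (iSup_mono fun N => ?_)
  rw [Matr.iSup_apply']
  exact hF.inf_iSup_le _ _

/-- Local localicity moves the meet inside the supremum defining the matrix product; modularity of
`Q` then applies to each term. -/
theorem Matr.isModular [InvolutiveQuantaloid Q] (hF : IsLocallyLocalic Q) (hM : IsModular Q) :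
    IsModular (Matr Q) := by
  intro A B D M N P a d
  rw [Matr.inf_apply, Matr.comp_apply, Matr.comp_apply, inf_comm]
  refine (hF.inf_iSup_le _ _).trans (iSup_mono fun b => ?_)
  rw [inf_comm]
  refine (hM _ _ _).trans (comp_mono le_rfl ?_)
  rw [Matr.inf_apply, Matr.comp_apply]
  exact inf_le_inf le_rfl (le_iSup (fun a' => (Mᵒ) b a' ≫ P a' d) a)

theorem MatrixQuantale.isLocallyLocalic (hF : IsLocallyLocalic Q) :
    IsLocallyLocalic (MatrixQuantale Q) :=
  fun _ _ M S => Matr.isLocallyLocalic hF M S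

theorem MatrixQuantale.isModular [InvolutiveQuantaloid Q] (hF : IsLocallyLocalic Q)
    (hM : IsModular Q) : IsModular (MatrixQuantale Q) :=
  fun _ _ _ M N P => Matr.isModular hF hM (X := Matr.objects Q) (Y := Matr.objects Q)
    (Z := Matr.objects Q) M N P

/-- The element at `(X, Y)` of a matrix in `Qᵐ`. -/
def MatrixQuantale.entry {s t : MatrixQuantale Q} (M : s ⟶ t) (X Y : Q) : X ⟶ Y := M X Y

theorem MatrixQuantale.le_iff {s t : MatrixQuantale Q} {M N : s ⟶ t} :
    M ≤ N ↔ ∀ X Y, entry M X Y ≤ entry N X Y := Iff.rfl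

theorem MatrixQuantale.entry_comp {s t r : MatrixQuantale Q} (M : s ⟶ t) (N : t ⟶ r) (X Z : Q) :
    entry (M ≫ N) X Z = ⨆ Y : Q, entry M X Y ≫ entry N Y Z := rfl

theorem MatrixQuantale.entry_inv [InvolutiveQuantaloid Q] {s t : MatrixQuantale Q} (M : s ⟶ t)
    (X Y : Q) : entry (Mᵒ) X Y = (entry M Y X)ᵒ := rfl

open MatrixQuantale

theorem entry_elementaryMatrix {A B : Q} (f : A ⟶ B) (X Y : Q) :
    entry (elementaryMatrix f) X Y = ⨆ (h : X = A) (k : B = Y), eqToHom h ≫ f ≫ eqToHom k := rfl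

theorem entry_elementaryMatrix_self {A B : Q} (f : A ⟶ B) :
    entry (elementaryMatrix f) A B = f := by
  simp [entry_elementaryMatrix]

/-- All other elements of `M_f` are zero, so a single element decides the inequality. -/
theorem elementaryMatrix_le_iff {A B : Q} {f : A ⟶ B}
    {M : (MatrixQuantale.star : MatrixQuantale Q) ⟶ MatrixQuantale.star} :
    elementaryMatrix f ≤ M ↔ f ≤ entry M A B := by
  constructor
  · intro h
    simpa only [entry_elementaryMatrix_self] using MatrixQuantale.le_iff.1 h A B
  · refine fun h => MatrixQuantale.le_iff.2 fun X Y => ?_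
    rw [entry_elementaryMatrix]
    refine iSup₂_le ?_
    rintro rfl rfl
    refine le_trans (le_of_eq ?_) h
    simp

theorem elementaryMatrix_mono {A B : Q} {f g : A ⟶ B} (h : f ≤ g) :
    elementaryMatrix f ≤ elementaryMatrix g := by
  rwa [elementaryMatrix_le_iff, entry_elementaryMatrix_self]

/-- Compressing by the diagonal idempotents isolates one element; this is why the embedding of `Q`
is full. -/
theorem elementaryMatrix_comp_comp {A B : Q}
    (M : (MatrixQuantale.star : MatrixQuantale Q) ⟶ MatrixQuantale.star) :
    elementaryMatrix (𝟙 A) ≫ M ≫ elementaryMatrix (𝟙 B) = elementaryMatrix (entry M A B) := by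
  apply le_antisymm
  · refine MatrixQuantale.le_iff.2 fun X Y => ?_
    simp only [entry_comp, entry_elementaryMatrix, iSup_comp, comp_iSup]
    refine iSup_le fun Z => iSup_le fun V => iSup_le fun h => iSup_le fun k =>
      iSup_le fun h' => iSup_le fun k' => ?_
    subst h k h' k'
    simp
  · rw [elementaryMatrix_le_iff, entry_comp]
    refine le_iSup_of_le A ?_
    rw [entry_comp, entry_elementaryMatrix_self, Category.id_comp]
    refine le_iSup_of_le B ?_
    rw [entry_elementaryMatrix_self, Category.comp_id]

theorem elementaryMatrix_id_le (A : Q) :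
    elementaryMatrix (𝟙 A) ≤ 𝟙 (MatrixQuantale.star : MatrixQuantale Q) := by
  rw [elementaryMatrix_le_iff]
  exact le_iSup (fun _ : A = A => 𝟙 A) rfl

end Matrices

/-! ### Splitting symmetric idempotents -/

section Splitting

variable {P : Type u} [Category.{v} P] [Quantaloid P] [InvolutiveQuantaloid P]
  {E : Set (SymIdempotent P)}

theorem Split.le_iff {e f : Split E} {x y : e ⟶ f} : x ≤ y ↔ x.val ≤ y.val := Iff.rfl

theorem Split.hom_ext {e f : Split E} {x y : e ⟶ f} (h : x.val = y.val) : x = y := SplitHom.ext h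

theorem Split.iSup_val {e f : Split E} {ι : Sort*} (x : ι → (e ⟶ f)) :
    (⨆ i, x i).val = ⨆ i, (x i).val := SplitHom.iSup_val x

theorem Split.sSup_val {e f : Split E} (S : Set (e ⟶ f)) :
    (sSup S).val = ⨆ x ∈ S, x.val := rfl

/-- Modularity gives `x ⊓ y = (e ≫ x) ⊓ y ≤ e ≫ (x ⊓ e ≫ y) = e ≫ (x ⊓ y)`, and dually for `f`; so
the infimum taken in `P` is again a morphism of the splitting. -/
theorem Split.inf_val (hM : IsModular P) {e f : Split E} (x y : e ⟶ f) :
    (x ⊓ y).val = x.val ⊓ y.val := by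
  apply le_antisymm
  · exact le_inf (Split.le_iff.1 inf_le_left) (Split.le_iff.1 inf_le_right)
  · have h1 : x.val ⊓ y.val ≤ e.idempotent.e ≫ (x.val ⊓ y.val) := by
      have := hM e.idempotent.e x.val y.val
      rwa [x.left, e.idempotent.symm, y.left] at this
    have h2 : x.val ⊓ y.val ≤ (x.val ⊓ y.val) ≫ f.idempotent.e := by
      have := hM.comp_inf_le x.val f.idempotent.e y.val
      rwa [x.right, f.idempotent.symm, y.right] at this
    let z : e ⟶ f := ⟨x.val ⊓ y.val,
      le_antisymm (le_inf
        ((comp_mono le_rfl inf_le_left).trans x.left.le)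
        ((comp_mono le_rfl inf_le_right).trans y.left.le)) h1,
      le_antisymm (le_inf
        ((comp_mono inf_le_left le_rfl).trans x.right.le)
        ((comp_mono inf_le_right le_rfl).trans y.right.le)) h2⟩
    have hx : z ≤ x := Split.le_iff.2 inf_le_left
    have hy : z ≤ y := Split.le_iff.2 inf_le_right
    exact Split.le_iff.1 (le_inf hx hy)

theorem Split.isLocallyLocalic (hF : IsLocallyLocalic P) (hM : IsModular P) :
    IsLocallyLocalic (Split E) := by
  intro e f x S
  rw [Split.le_iff, Split.inf_val hM, Split.sSup_val, Split.iSup_val]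
  refine (hF.inf_iSup_le _ _).trans (iSup_mono fun y => ?_)
  rw [Split.iSup_val]
  refine (hF.inf_iSup_le _ _).trans (iSup_mono fun hy => ?_)
  rw [Split.inf_val hM]

theorem Split.isModular (hM : IsModular P) : IsModular (Split E) := by
  intro e f g x y z
  rw [Split.le_iff, Split.inf_val hM, Split.comp_val, Split.comp_val, Split.inf_val hM,
    Split.comp_val]
  exact hM _ _ _

theorem Split.isMap_iff {e f : Split E} {x : e ⟶ f} :
    IsMap x ↔ e.idempotent.e ≤ x.val ≫ (x.val)ᵒ ∧ (x.val)ᵒ ≫ x.val ≤ f.idempotent.e := Iff.rfl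

end Splitting

/-! ### The embedding of `Q` into `(Qᵐ)_E` is dense and fully faithful -/

/-- A homomorphism `F` is dense if every morphism `q` of its codomain is the supremum of the
`τ ∘ σᵒ` below it with `σ` and `τ` maps whose domain is in the image of `F`. -/
def InvolutiveHom.IsDense {Q : Type u} [Category.{v} Q] [Quantaloid Q] [InvolutiveQuantaloid Q]
    {P : Type u'} [Category.{v'} P] [Quantaloid P] [InvolutiveQuantaloid P]
    (F : InvolutiveHom Q P) : Prop :=
  ∀ ⦃e f : P⦄ (q r : e ⟶ f), (∀ ⦃W : Q⦄ (σ : F.obj W ⟶ e) (τ : F.obj W ⟶ f),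
    IsMap σ → IsMap τ → σᵒ ≫ τ ≤ q → σᵒ ≫ τ ≤ r) → q ≤ r

theorem InvolutiveHom.IsDense.isWeaklyTabular {Q : Type u} [Category.{v} Q] [Quantaloid Q]
    [InvolutiveQuantaloid Q] {P : Type u'} [Category.{v'} P] [Quantaloid P]
    [InvolutiveQuantaloid P] {F : InvolutiveHom Q P} (hF : F.IsDense) : IsWeaklyTabular P :=
  fun _ _ q r H => hF q r fun _ σ τ => H σ τ

section Density

variable {Q : Type u} [SmallCategory Q] [Quantaloid Q] [InvolutiveQuantaloid Q]

instance (E : Set (SymIdempotent (MatrixQuantale Q))) (hE : ∀ A : Q, elementaryIdempotent A ∈ E) :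
    (matrixEmbedding E hE).Faithful where
  map_injective {A B f g} h := by
    rw [← entry_elementaryMatrix_self f,
      ← entry_elementaryMatrix_self g]
    exact congrArg (fun x => MatrixQuantale.entry x A B) (congrArg SplitHom.val h)

instance (E : Set (SymIdempotent (MatrixQuantale Q))) (hE : ∀ A : Q, elementaryIdempotent A ∈ E) :
    (matrixEmbedding E hE).Full where
  map_surjective {A B} x := by
    refine ⟨MatrixQuantale.entry x.val A B, Split.hom_ext ?_⟩
    have h := elementaryMatrix_comp_comp (A := A) (B := B) x.val
    refine h.symm.trans ?_
    have hr : x.val ≫ elementaryMatrix (𝟙 B) = x.val := x.right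
    have hl : elementaryMatrix (𝟙 A) ≫ x.val = x.val := x.left
    rw [hr, hl]

/-- The counit of `m ⊣ mᵒ` survives in the quantale because `M_{1_X}` is below the unit matrix; the
unit of the adjunction need not. -/
theorem elementaryMatrix_inv_comp_comp_le {W X : Q} {m : W ⟶ X} (hm : IsMap m)
    (y : (MatrixQuantale.star : MatrixQuantale Q) ⟶ MatrixQuantale.star) :
    (elementaryMatrix m)ᵒ ≫ elementaryMatrix m ≫ y ≤ y := by
  rw [← elementaryMatrix_inv, ← Category.assoc, elementaryMatrix_comp]
  refine (comp_mono ((elementaryMatrix_mono hm.2).trans (elementaryMatrix_id_le X)) le_rfl).trans ?_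
  rw [Category.id_comp]

/-- If `m` and `n` are maps with `n ∘ mᵒ` below the element at `(X, Y)` of a matrix factoring
through `e`, then the row `e ∘ M_m` is total. -/
theorem elementaryMatrix_id_le_of_le (hM : IsModular (MatrixQuantale Q)) {W X Y : Q} {m : W ⟶ X}
    {n : W ⟶ Y} (hm : IsMap m) (hn : IsMap n)
    {e x : (MatrixQuantale.star : MatrixQuantale Q) ⟶ MatrixQuantale.star}
    (hx : e ≫ x = x) (h : mᵒ ≫ n ≤ MatrixQuantale.entry x X Y) :
    elementaryMatrix (𝟙 W) ≤ (elementaryMatrix m ≫ e) ≫ (elementaryMatrix m ≫ e)ᵒ := by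
  have h1 : elementaryMatrix (𝟙 W) ≤
      (elementaryMatrix m ≫ e) ≫ x ≫ (elementaryMatrix n)ᵒ := by
    have h2 : 𝟙 W ≤ m ≫ (mᵒ ≫ n) ≫ nᵒ := by
      simpa using hn.1.trans (comp_mono (hm.le_comp_inv_comp n) le_rfl)
    refine (elementaryMatrix_mono h2).trans ?_
    rw [← elementaryMatrix_comp, ← elementaryMatrix_comp, elementaryMatrix_inv, Category.assoc,
      ← Category.assoc e, hx]
    exact comp_mono le_rfl (comp_mono (elementaryMatrix_le_iff.2 h) le_rfl)
  -- Being coreflexive, `M_{1_W}` lies in the meet to which `id_inf_comp_le` applies, which trades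
  -- the factor `x ≫ M_nᵒ` for the involute of `M_m ≫ e`.
  refine (le_inf (elementaryMatrix_id_le W) h1).trans ((hM.id_inf_comp_le _ _).trans ?_)
  exact comp_mono inf_le_left (inv_mono inf_le_left)

/-- Each element of `q` is tested on spans of maps `(m, n)` of `Q`. Although `M_m` need not be a map
in the quantale, `M_m ≫ e` and `M_n ≫ f` are maps out of `M_{1_W}` in the splitting, total because
`q` absorbs `e` and `f`. -/
theorem matrixEmbedding_isDense (hT : IsWeaklyTabular Q) (hM : IsModular (MatrixQuantale Q))
    (E : Set (SymIdempotent (MatrixQuantale Q))) (hE : ∀ A : Q, elementaryIdempotent A ∈ E) :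
    (matrixEmbedding E hE).IsDense := by
  rintro ⟨⟨⟨⟩, e, hee, hes⟩, he⟩ ⟨⟨⟨⟩, f, hff, hfs⟩, hf⟩ ⟨q, hql, hqr⟩ ⟨r, hrl, hrr⟩ H
  change e ≫ q = q at hql
  change q ≫ f = q at hqr
  refine MatrixQuantale.le_iff.2 fun X Y => hT _ _ fun W m n hm hn hmn => ?_
  have hm1 := elementaryMatrix_id_le_of_le hM hm hn hql hmn
  -- The same argument for `qᵒ`, with the legs exchanged.
  have hn1 : elementaryMatrix (𝟙 W) ≤
      (elementaryMatrix n ≫ f) ≫ (elementaryMatrix n ≫ f)ᵒ := by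
    refine elementaryMatrix_id_le_of_le hM hn hm (x := qᵒ) (Y := X) ?_ ?_
    · nth_rw 1 [← hfs]
      rw [← InvolutiveQuantaloid.inv_comp, hqr]
    · rw [MatrixQuantale.entry_inv, le_inv_iff, InvolutiveQuantaloid.inv_comp,
        InvolutiveQuantaloid.inv_inv]
      exact hmn
  have hmle : (elementaryMatrix m ≫ e)ᵒ ≫ elementaryMatrix m ≫ e ≤ e := by
    rw [InvolutiveQuantaloid.inv_comp, Category.assoc, hes]
    exact (comp_mono le_rfl (elementaryMatrix_inv_comp_comp_le hm e)).trans hee.le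
  have hnle : (elementaryMatrix n ≫ f)ᵒ ≫ elementaryMatrix n ≫ f ≤ f := by
    rw [InvolutiveQuantaloid.inv_comp, Category.assoc, hfs]
    exact (comp_mono le_rfl (elementaryMatrix_inv_comp_comp_le hn f)).trans hff.le
  have key := H (W := W)
    ⟨elementaryMatrix m ≫ e, by
      change elementaryMatrix (𝟙 W) ≫ elementaryMatrix m ≫ e = _
      rw [← Category.assoc, elementaryMatrix_comp, Category.id_comp],
      by
        change (elementaryMatrix m ≫ e) ≫ e = _
        rw [Category.assoc, hee]⟩
    ⟨elementaryMatrix n ≫ f, by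
      change elementaryMatrix (𝟙 W) ≫ elementaryMatrix n ≫ f = _
      rw [← Category.assoc, elementaryMatrix_comp, Category.id_comp],
      by
        change (elementaryMatrix n ≫ f) ≫ f = _
        rw [Category.assoc, hff]⟩
    (Split.isMap_iff.2 ⟨hm1, hmle⟩) (Split.isMap_iff.2 ⟨hn1, hnle⟩)
  have hval : (elementaryMatrix m ≫ e)ᵒ ≫ elementaryMatrix n ≫ f =
      e ≫ elementaryMatrix (mᵒ ≫ n) ≫ f := by
    rw [InvolutiveQuantaloid.inv_comp, hes, ← elementaryMatrix_comp, elementaryMatrix_inv]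
    simp only [Category.assoc]
  have key' : (elementaryMatrix m ≫ e)ᵒ ≫ elementaryMatrix n ≫ f ≤ r := by
    refine key ?_
    change (elementaryMatrix m ≫ e)ᵒ ≫ elementaryMatrix n ≫ f ≤ q
    rw [hval, ← hql, ← hqr]
    exact comp_mono le_rfl (comp_mono (elementaryMatrix_le_iff.2 hmn) le_rfl)
  -- It remains to see `M_{mᵒ ≫ n} ≤ σᵒ ≫ τ` for `σ = M_m ≫ e` and `τ = M_n ≫ f`: insert `σ ≫ σᵒ`
  -- and `τ ≫ τᵒ` in the middle, then absorb the outer factors.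
  refine elementaryMatrix_le_iff.1 (le_trans ?_ key')
  have hα : (elementaryMatrix m)ᵒ ≫ (elementaryMatrix m ≫ e) ≫ (elementaryMatrix m ≫ e)ᵒ ≤
      (elementaryMatrix m ≫ e)ᵒ := by
    rw [← Category.assoc]
    refine (comp_mono (elementaryMatrix_inv_comp_comp_le hm e) le_rfl).trans (le_of_eq ?_)
    nth_rw 1 [← hes]
    rw [← InvolutiveQuantaloid.inv_comp, Category.assoc, hee]
  have hβ : ((elementaryMatrix n ≫ f) ≫ (elementaryMatrix n ≫ f)ᵒ) ≫ elementaryMatrix n ≤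
      elementaryMatrix n ≫ f := by
    rw [← inv_le_inv_iff]
    simp only [InvolutiveQuantaloid.inv_comp, InvolutiveQuantaloid.inv_inv, hfs, Category.assoc]
    refine (elementaryMatrix_inv_comp_comp_le hn _).trans (le_of_eq ?_)
    rw [← Category.assoc, hff]
  have h0 : elementaryMatrix (mᵒ ≫ n) = ((elementaryMatrix m)ᵒ ≫ elementaryMatrix (𝟙 W)) ≫
      elementaryMatrix (𝟙 W) ≫ elementaryMatrix n := by
    rw [← elementaryMatrix_inv, elementaryMatrix_comp, elementaryMatrix_comp,
      elementaryMatrix_comp, Category.id_comp, Category.comp_id]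
  rw [h0]
  exact comp_mono ((comp_mono le_rfl hm1).trans hα) ((comp_mono hn1 le_rfl).trans hβ)

end Density

/-! ### Equivalences of involutive quantaloids -/

section Equivalence

variable {Q : Type u} [Category.{v} Q] [Quantaloid Q] [InvolutiveQuantaloid Q]
  {R : Type u'} [Category.{v'} R] [Quantaloid R] [InvolutiveQuantaloid R]

/-- A fully faithful homomorphism of involutive quantaloids for which every object of the codomain
is symmetrically isomorphic to one in the image is an equivalence of involutive quantaloids. -/
theorem InvolutiveHom.isEquivalence_of_fullyFaithful (F : InvolutiveHom Q R)
    [F.toFunctor.Full] [F.toFunctor.Faithful]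
    (hF : ∀ B : R, ∃ (A : Q) (u : F.obj A ≅ B), u.inv = u.homᵒ) : F.IsEquivalence := by
  choose G u hu using hF
  have hu' : ∀ B, (u B).invᵒ = (u B).hom := fun B => by
    rw [hu, InvolutiveQuantaloid.inv_inv]
  let GF : R ⥤ Q :=
    { obj := G
      map := fun {B B'} q => F.toFunctor.preimage ((u B).hom ≫ q ≫ (u B').inv)
      map_id := fun B => F.toFunctor.map_injective (by simp)
      map_comp := fun q r => F.toFunctor.map_injective (by simp) }
  have hG : ∀ {B B' : R} (q : B ⟶ B'), F.map (GF.map q) = (u B).hom ≫ q ≫ (u B').inv :=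
    fun q => F.toFunctor.map_preimage _
  let GH : InvolutiveHom R Q :=
    { GF with
      map_sSup := fun {B B'} S => F.toFunctor.map_injective (by
        rw [hG, F.map_iSup, Quantaloid.sSup_comp, comp_iSup]
        refine iSup_congr fun q => ?_
        rw [comp_iSup, F.map_iSup]
        exact iSup_congr fun _ => (hG q).symm)
      -- Conjugation by the `u B` commutes with the involution precisely because their inverses are
      -- their involutes.
      map_inv := fun {B B'} q => F.toFunctor.map_injective (by
        rw [hG, F.map_inv, hG, InvolutiveQuantaloid.inv_comp, InvolutiveQuantaloid.inv_comp,
          hu', ← hu, Category.assoc]) }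
  let ε : GF ⋙ F.toFunctor ≅ 𝟭 R := NatIso.ofComponents u (fun {B B'} q => by
    change F.map (GF.map q) ≫ (u B').hom = (u B).hom ≫ q
    rw [hG]
    simp)
  let η : 𝟭 Q ≅ F.toFunctor ⋙ GF := NatIso.ofComponents
    (fun A => (F.toFunctor.preimageIso (u (F.obj A))).symm) (fun {A A'} q => by
      refine F.toFunctor.map_injective ?_
      change F.map (q ≫ F.toFunctor.preimage (u (F.obj A')).inv) =
        F.map (F.toFunctor.preimage (u (F.obj A)).inv ≫ GF.map (F.map q))
      rw [F.map_comp, F.map_comp, hG, F.toFunctor.map_preimage, F.toFunctor.map_preimage]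
      simp)
  refine ⟨GH, η, ε, fun A => ?_, hu⟩
  refine F.toFunctor.map_injective ?_
  change F.map (F.toFunctor.preimage (u (F.obj A)).hom) =
    F.map ((F.toFunctor.preimage (u (F.obj A)).inv)ᵒ)
  rw [F.map_inv, F.toFunctor.map_preimage, F.toFunctor.map_preimage, hu']

theorem InvolutiveHom.map_le_map_iff (F : InvolutiveHom Q R) [F.toFunctor.Faithful] {X Y : Q}
    {f g : X ⟶ Y} : F.map f ≤ F.map g ↔ f ≤ g :=
  IsHomomorphism.map_le_map_iff F.map_sSup

/-- For maps, `σᵒ ≫ τ ≤ 1` forces `τ = σ`, so density at the identity involves only the `σᵒ ≫ σ`. -/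
theorem InvolutiveHom.IsDense.id_le {F : InvolutiveHom Q R} (hF : F.IsDense) {e : R} {r : e ⟶ e}
    (H : ∀ ⦃W : Q⦄ (σ : F.obj W ⟶ e), IsMap σ → σᵒ ≫ σ ≤ r) : 𝟙 e ≤ r := by
  refine hF _ _ fun W σ τ hσ hτ h => ?_
  have h' := hσ.inv_comp_le_iff.1 h
  rw [Category.comp_id] at h'
  rw [hτ.eq_of_le hσ h']
  exact H σ hσ

end Equivalence

/-! ### Change of base along a dense fully faithful homomorphism -/

section ChangeBase

variable {Q : Type u} [SmallCategory Q] [Quantaloid Q] [InvolutiveQuantaloid Q]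
  {R : Type u} [SmallCategory R] [Quantaloid R] [InvolutiveQuantaloid R]
  (F : InvolutiveHom Q R)

instance [F.toFunctor.Faithful] : (changeBase F).toFunctor.Faithful where
  map_injective {A B Φ Ψ} h := Distributor.ext (by
    funext x y
    exact F.toFunctor.map_injective (congrFun (congrFun (congrArg Distributor.elem h) x) y))

instance [F.toFunctor.Full] [F.toFunctor.Faithful] : (changeBase F).toFunctor.Full where
  map_surjective {A B} Φ := by
    have hl : ∀ {X Y Z : Q} (a : X ⟶ Y) (p : F.obj Y ⟶ F.obj Z) (q : F.obj X ⟶ F.obj Z),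
        F.map a ≫ p ≤ q → a ≫ F.toFunctor.preimage p ≤ F.toFunctor.preimage q := by
      intro X Y Z a p q h
      rwa [← F.map_le_map_iff, F.map_comp, F.toFunctor.map_preimage, F.toFunctor.map_preimage]
    have hr : ∀ {X Y Z : Q} (a : Y ⟶ Z) (p : F.obj X ⟶ F.obj Y) (q : F.obj X ⟶ F.obj Z),
        p ≫ F.map a ≤ q → F.toFunctor.preimage p ≫ a ≤ F.toFunctor.preimage q := by
      intro X Y Z a p q h
      rwa [← F.map_le_map_iff, F.map_comp, F.toFunctor.map_preimage, F.toFunctor.map_preimage]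
    refine ⟨⟨fun x y => F.toFunctor.preimage (Φ.elem x y),
      fun x' x y => hl _ _ _ (Φ.left_le x' x y), fun x y y' => hr _ _ _ (Φ.right_le x y y')⟩,
      Distributor.ext ?_⟩
    funext x y
    exact F.toFunctor.map_preimage _

/-! ### Resolving a symmetric category by maps from the image of `F` -/

section Resolution

variable [F.toFunctor.Full] (B : SymDist R)

/-- The maps from objects in the image of `F` to types of `B`. -/
structure MapInto where
  elt : B.carrier
  dom : Q
  map : F.obj dom ⟶ B.type elt
  isMap : IsMap map

variable {F B}

/-- The hom-arrow in `Q` between two maps into the types of `B`. -/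
noncomputable def MapInto.hom (a b : MapInto F B) : a.dom ⟶ b.dom :=
  F.toFunctor.preimage (a.map ≫ B.hom a.elt b.elt ≫ b.mapᵒ)

theorem MapInto.map_hom (a b : MapInto F B) :
    F.map (a.hom b) = a.map ≫ B.hom a.elt b.elt ≫ b.mapᵒ :=
  F.toFunctor.map_preimage _

/-- The inner `bᵒ ≫ b` collapses and composition in `B` does the rest. This gives both the
composition law of `mapsInto` and the left action on the evaluation distributor. -/
theorem MapInto.map_hom_comp_le (a b : MapInto F B) (y : B.carrier) :
    F.map (a.hom b) ≫ b.map ≫ B.hom b.elt y ≤ a.map ≫ B.hom a.elt y := by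
  rw [map_hom, Category.assoc, Category.assoc]
  exact comp_mono le_rfl ((comp_mono le_rfl (b.isMap.inv_comp_comp_le _)).trans (B.comp_le _ _ _))

variable [F.toFunctor.Faithful]

theorem MapInto.id_le (a : MapInto F B) : 𝟙 a.dom ≤ a.hom a := by
  rw [← F.map_le_map_iff, F.map_id, map_hom]
  refine a.isMap.1.trans (comp_mono le_rfl ?_)
  simpa using comp_mono (B.id_le a.elt) (le_refl (a.mapᵒ))

theorem MapInto.comp_le (a b c : MapInto F B) : a.hom b ≫ b.hom c ≤ a.hom c := by
  rw [← F.map_le_map_iff, F.map_comp, map_hom b, map_hom a c, ← Category.assoc b.map,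
    ← Category.assoc, ← Category.assoc a.map]
  exact comp_mono (a.map_hom_comp_le b _) le_rfl

theorem MapInto.hom_symm (a b : MapInto F B) : a.hom b = (b.hom a)ᵒ :=
  F.toFunctor.map_injective (by
    rw [F.map_inv, map_hom, map_hom, InvolutiveQuantaloid.inv_comp, InvolutiveQuantaloid.inv_comp,
      InvolutiveQuantaloid.inv_inv, ← B.symm, Category.assoc])

variable (F B)

/-- The symmetric `Q`-category of maps from the image of `F` to the types of `B`. -/
noncomputable def mapsInto : SymDist Q where
  carrier := MapInto F B
  type a := a.dom
  hom a b := a.hom b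
  id_le a := a.id_le
  comp_le a b c := a.comp_le b c
  symm a b := a.hom_symm b

/-- The evaluation distributor from the image of `mapsInto F B` to `B`. -/
noncomputable def mapsIntoEval : (changeBase F).obj (mapsInto F B) ⟶ B :=
  let elem (a : MapInto F B) (y : B.carrier) : F.obj a.dom ⟶ B.type y := a.map ≫ B.hom a.elt y
  have right_le (a : MapInto F B) (y y' : B.carrier) : elem a y ≫ B.hom y y' ≤ elem a y' := by
    rw [Category.assoc]
    exact comp_mono le_rfl (B.comp_le _ _ _)
  { elem := elem
    left_le := MapInto.map_hom_comp_le
    right_le := right_le }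

theorem iSup_hom_comp_hom (x z : B.carrier) : ⨆ y, B.hom x y ≫ B.hom y z = B.hom x z :=
  congrFun (congrFun (congrArg Distributor.elem (Distributor.id_comp (Distributor.id
    B.toEnrichedCat))) x) z

/-- The hom-arrows of `mapsInto` were chosen for this; density plays no part on this side. -/
theorem mapsIntoEval_comp_inv : mapsIntoEval F B ≫ (mapsIntoEval F B)ᵒ = 𝟙 _ := by
  have key (a b : MapInto F B) : ⨆ y, (a.map ≫ B.hom a.elt y) ≫ (b.map ≫ B.hom b.elt y)ᵒ =
      F.map (a.hom b) := by
    rw [MapInto.map_hom, ← iSup_hom_comp_hom, iSup_comp, comp_iSup]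
    refine iSup_congr fun y => ?_
    rw [InvolutiveQuantaloid.inv_comp, ← B.symm]
    simp only [Category.assoc]
  exact Distributor.ext (funext fun a => funext fun b => key a b)

-- One inequality uses `σᵒ ≫ σ ≤ 1` for each map, the other that by density these have supremum
-- above `1`.
variable {F} in
theorem inv_comp_mapsIntoEval (hF : F.IsDense) :
    (mapsIntoEval F B)ᵒ ≫ mapsIntoEval F B = 𝟙 B := by
  have key (y z : B.carrier) :
      ⨆ a : MapInto F B, (a.map ≫ B.hom a.elt y)ᵒ ≫ a.map ≫ B.hom a.elt z = B.hom y z := by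
    simp only [InvolutiveQuantaloid.inv_comp, ← B.symm, Category.assoc]
    apply le_antisymm
    · exact iSup_le fun a => (comp_mono le_rfl (a.isMap.inv_comp_comp_le _)).trans
        (B.comp_le _ _ _)
    · have h : 𝟙 (B.type y) ≤ ⨆ a : {a : (W : Q) × (F.obj W ⟶ B.type y) // IsMap a.2},
          a.1.2ᵒ ≫ a.1.2 :=
        hF.id_le fun W σ hσ => le_iSup
          (fun a : {a : (W : Q) × (F.obj W ⟶ B.type y) // IsMap a.2} => a.1.2ᵒ ≫ a.1.2)
          ⟨⟨W, σ⟩, hσ⟩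
      rw [← Category.id_comp (B.hom y z)]
      refine (comp_mono h le_rfl).trans ?_
      rw [iSup_comp]
      -- Maps into the type of `y` itself suffice, the extra factor `B.hom y y` being above the
      -- identity.
      refine iSup_le fun ⟨⟨W, σ⟩, hσ⟩ => le_iSup_of_le ⟨y, W, σ, hσ⟩ ?_
      simpa using comp_mono (B.id_le y) (le_refl (σᵒ ≫ σ ≫ B.hom y z))
  exact Distributor.ext (funext fun y => funext fun z => key y z)

end Resolution

/-- Change of base along a dense fully faithful homomorphism is an equivalence. -/
theorem changeBase_isEquivalence [F.toFunctor.Full] [F.toFunctor.Faithful] (hF : F.IsDense) :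
    (changeBase F).IsEquivalence :=
  (changeBase F).isEquivalence_of_fullyFaithful fun B => ⟨mapsInto F B,
    ⟨mapsIntoEval F B, (mapsIntoEval F B)ᵒ, mapsIntoEval_comp_inv F B,
      inv_comp_mapsIntoEval B hF⟩, rfl⟩

end ChangeBase

end QuantaloidTheory

theorem mainTheorem8 {Q : Type u} [SmallCategory Q] [Quantaloid Q] [InvolutiveQuantaloid Q]
    (hQ : IsSmallQuantaloidOfClosedCribles Q)
    (E : Set (SymIdempotent (MatrixQuantale Q))) (hE : ∀ A : Q, elementaryIdempotent A ∈ E) :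
    IsSmallQuantaloidOfClosedCribles (Split E) ∧
      (changeBase (matrixEmbedding E hE)).IsEquivalence := by
  have hF := MatrixQuantale.isLocallyLocalic hQ.isLocallyLocalic
  have hM := MatrixQuantale.isModular hQ.isLocallyLocalic hQ.isModular
  have hD := matrixEmbedding_isDense hQ.isWeaklyTabular hM E hE
  exact ⟨isSmallQuantaloidOfClosedCribles_of_isModular (Split.isLocallyLocalic hF hM)
    (Split.isModular hM) hD.isWeaklyTabular, changeBase_isEquivalence _ hD⟩
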